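/- **Setting.** Let $n\ge 2$ agents be connected by an undirected connected graph on $\{1,\dots,n\}$ with mixing matrix $W=(w_{ij})\in\mathbb R^{n\times n}$ that is nonnegative, symmetric and stochastic ($W\mathbf 1=\mathbf 1$), with, for $i\ne j$, $w_{ij}>0$ if $i,j$ are adjacent and $w_{ij}=0$ otherwise. Let $\lambda_2$ be the second largest eigenvalue of $W$ (with multiplicity). Let $f_i:\mathbb R^p\to\mathbb R$ ($1\le i\le n$) be differentiable with $L$-Lipschitz gradients ($L>0$) and $f_i\ge \underline f_i$; put $f=\frac1n\sum_i f_i$, $f^{\inf}=\frac1n\sum_i\underline f_i$. Agent $i$ has a measurable stochastic gradient $g_i(x;\xi)$ and samples $\xi_{i,k}$ ($k\ge -1$) such that for all $x,k$: $\mathbb E[g_i(x;\xi_{i,k})]=\nabla f_i(x)$ and $\mathbb E\|g_i(x;\xi_{i,k})-\nabla f_i(x)\|^2\le\sigma^2$ ($\sigma>0$). The (possibly random) compression operator $\mathcal C(x)=\mathcal C(x;\zeta)$, measurable, with samples $\zeta_{i,k}$ ($k\ge 0$), satisfies $\mathbb E\,\mathcal C(x;\zeta_{i,k})=x$ and $\mathbb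 E\|\mathcal C(x;\zeta_{i,k})-x\|^2\le C\|x\|^2$ for all $x,i,k$, with $C=0$ (no compression). All the samples $\xi_{i,k},\zeta_{i,k}$ are mutually independent. **Algorithm (CEDAS).** Given stepsizes $\eta_k$, parameters $\alpha,\gamma$ and deterministic initial vectors $x_{i,-1},h_{i,0}\in\mathbb R^p$, put $d_{i,0}=0$, $(h_w)_{i,0}=\sum_j w_{ij}h_{j,0}$, $x_{i,0}=x_{i,-1}-\eta_{-1}g_i(x_{i,-1};\xi_{i,-1})$, and for $k=0,1,\dots$ $$y_{i,k}=x_{i,k}-\eta_k g_i(x_{i,k};\xi_{i,k})-d_{i,k},\quad q_{i,k}=\mathcal C(y_{i,k}-h_{i,k};\zeta_{i,k}),\quad \hat y_{i,k}=h_{i,k}+q_{i,k},\quad (\hat y_w)_{i,k}=(h_w)_{i,k}+\sum_j w_{ij}q_{j,k},$$ $$h_{i,k+1}=(1-\alpha)h_{i,k}+\alpha\hat y_{i,k},\quad (h_w)_{i,k+1}=(1-\alpha)(h_w)_{i,k}+\alpha(\hat y_w)_{i,k},$$ $$d_{i,k+1}=d_{i,k}+\tfrac{\gamma}{2}\big(\hat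 y_{i,k}-(\hat y_w)_{i,k}\big),\quad x_{i,k+1}=x_{i,k}-\eta_k g_i(x_{i,k};\xi_{i,k})-d_{i,k+1}.$$ Write $\bar x_k=\frac1n\sum_i x_{i,k}$, $\mathbf x_{-1}$ and $H_0$ for the $n\times p$ matrices with rows $x_{i,-1}$ and $h_{i,0}$, and $\nabla F(\mathbf x_{-1})$ for the one with rows $\nabla f_i(x_{i,-1})$; $\|\cdot\|$ is the Frobenius norm. For the horizon $K$ (number of iterations) run the algorithm with $$\alpha=1,\qquad \gamma=\tfrac12,\qquad \eta_k=\eta=\sqrt{n/K}\ \text{ for all } k,\qquad K\ge K_0:=\frac{512\,nL^2}{(1-\lambda_2)^2}.$$ **Transient time.** For $A>0$, let $K_T^{(ncvx)}$ be the least integer $K\ge K_0$ such that for every $k\ge K$ the run with horizon $k$ satisfies $$\frac1k\sum_{t=0}^{k-1}\mathbb E\big[\|\nabla f(\bar x_t)\|^2\big]\le\frac{A}{\sqrt{nk}},$$ all these expectations being finite. **Claim.** For all $L,\sigma>0$ and $\Delta\in\mathbb R$ there is $A>0$, and for all further reals $c_1,c_2,c_3,c_4$ and $q>0$ there is $B>0$,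 such that for all $n\ge2$, all $p$ and all data as above with $f(\bar x_{-1})-f^{\inf}\le\Delta$ and $$\|\mathbf x_{-1}\|^2\le c_1n^2,\qquad \|H_0\|\le c_2n^2,\qquad \|\nabla F(\mathbf x_{-1})\|^2\le c_3n^2,\qquad \frac1{1-\lambda_2}\le c_4n^q,$$ the transient time with rate constant $A$ exists and $$K_T^{(ncvx)}\le B\,\frac{n^3}{(1-\lambda_2)^2}.$$ That is, CEDAS without compression has transient time $O\big(n^3/(1-\lambda_2)^2\big)$ in the smooth nonconvex case. -/

import Mathlib

open MeasureTheory ProbabilityTheory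

namespace CEDAS

/-- Assumption on the network `G` on the agents `Fin n` and on the mixing matrix `W`. -/
structure IsMixingMatrix {n : ℕ} (G : SimpleGraph (Fin n)) (W : Matrix (Fin n) (Fin n) ℝ) :
    Prop where
  connected : G.Connected
  pos_of_adj : ∀ i j, G.Adj i j → 0 < W i j
  zero_of_not_adj : ∀ i j, i ≠ j → ¬ G.Adj i j → W i j = 0
  nonneg : ∀ i j, 0 ≤ W i j
  symm : W.IsHermitian
  stochastic : ∀ i, ∑ j, W i j = 1

/-- The second largest eigenvalue `λ₂` (with multiplicity) of a real symmetric matrix;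
`eigenvalues₀` lists the eigenvalues in nonincreasing order. -/
noncomputable def lambda2 {n : ℕ} (hn : 2 ≤ n) {W : Matrix (Fin n) (Fin n) ℝ}
    (hW : W.IsHermitian) : ℝ :=
  hW.eigenvalues₀ ⟨1, by rw [Fintype.card_fin]; exact hn⟩

/-- The average `(1/n) ∑ᵢ vᵢ` of the agents' vectors. -/
noncomputable def avg {n : ℕ} {V : Type*} [AddCommGroup V] [Module ℝ V] (v : Fin n → V) : V :=
  (n : ℝ)⁻¹ • ∑ i, v i

/-- The objective `f = (1/n) ∑ᵢ fᵢ`. -/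
noncomputable def objective {n p : ℕ} (f : Fin n → EuclideanSpace ℝ (Fin p) → ℝ) :
    EuclideanSpace ℝ (Fin p) → ℝ :=
  fun x => (n : ℝ)⁻¹ * ∑ i, f i x

/-- The Frobenius norm of the `n × p` matrix whose rows are the vectors `vᵢ`. -/
noncomputable def stackedNorm {n p : ℕ} (v : Fin n → EuclideanSpace ℝ (Fin p)) : ℝ :=
  Real.sqrt (∑ i, ‖v i‖ ^ 2)

/-- Each `fᵢ` has an `L`-Lipschitz continuous gradient and is bounded below by `fInf i`. -/
structure IsSmoothBelow {n p : ℕ} (L : ℝ) (f : Fin n → EuclideanSpace ℝ (Fin p) → ℝ)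
    (fInf : Fin n → ℝ) : Prop where
  differentiable : ∀ i, Differentiable ℝ (f i)
  lipschitz : ∀ i x y, ‖gradient (f i) x - gradient (f i) y‖ ≤ L * ‖x - y‖
  bounded_below : ∀ i x, fInf i ≤ f i x

/-- `g i x (ξ i k)` is the noisy gradient of `fᵢ` at `x` with the `k`-th sample of agent `i`:
it is unbiased and has variance at most `σ²`. -/
structure IsGradientOracle {n p : ℕ} {Ω Ξ : Type*} [MeasurableSpace Ω] [MeasurableSpace Ξ]
    (P : Measure Ω) (σ : ℝ) (f : Fin n → EuclideanSpace ℝ (Fin p) → ℝ)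
    (g : Fin n → EuclideanSpace ℝ (Fin p) → Ξ → EuclideanSpace ℝ (Fin p))
    (ξ : Fin n → ℕ → Ω → Ξ) : Prop where
  measurable : ∀ i, Measurable (Function.uncurry (g i))
  integrable : ∀ i k x, Integrable (fun ω => g i x (ξ i k ω)) P
  unbiased : ∀ i k x, ∫ ω, g i x (ξ i k ω) ∂P = gradient (f i) x
  integrable_sq : ∀ i k x,
    Integrable (fun ω => ‖g i x (ξ i k ω) - gradient (f i) x‖ ^ 2) P
  variance_le : ∀ i k x, ∫ ω, ‖g i x (ξ i k ω) - gradient (f i) x‖ ^ 2 ∂P ≤ σ ^ 2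

/-- The random compression operator `x ↦ 𝒞 x (ζ i k)` is unbiased with parameter `C`. -/
structure IsUnbiasedCompressor {n p : ℕ} {Ω Z : Type*} [MeasurableSpace Ω] [MeasurableSpace Z]
    (P : Measure Ω) (C : ℝ) (𝒞 : EuclideanSpace ℝ (Fin p) → Z → EuclideanSpace ℝ (Fin p))
    (ζ : Fin n → ℕ → Ω → Z) : Prop where
  measurable : Measurable (Function.uncurry 𝒞)
  integrable : ∀ i k x, Integrable (fun ω => 𝒞 x (ζ i k ω)) P
  unbiased : ∀ i k x, ∫ ω, 𝒞 x (ζ i k ω) ∂P = x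
  integrable_sq : ∀ i k x, Integrable (fun ω => ‖𝒞 x (ζ i k ω) - x‖ ^ 2) P
  variance_le : ∀ i k x, ∫ ω, ‖𝒞 x (ζ i k ω) - x‖ ^ 2 ∂P ≤ C * ‖x‖ ^ 2

/-- All gradient samples `ξ i k` and all compression samples `ζ i k` are measurable and mutually
independent (over agents, over iterations, and of each other). -/
structure IsIndependentNoise {n : ℕ} {Ω Ξ Z : Type*} [MeasurableSpace Ω] [MeasurableSpace Ξ]
    [MeasurableSpace Z] (P : Measure Ω) (ξ : Fin n → ℕ → Ω → Ξ) (ζ : Fin n → ℕ → Ω → Z) :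
    Prop where
  measurable_grad : ∀ i k, Measurable (ξ i k)
  measurable_comp : ∀ i k, Measurable (ζ i k)
  indep_pairs : iIndepFun (fun (a : Fin n × ℕ) ω => (ξ a.1 a.2 ω, ζ a.1 a.2 ω)) P
  indep_grad_comp : ∀ i k, IndepFun (ξ i k) (ζ i k) P

/-- The variables `d_{i,k}`, `h_{i,k}`, `(h_w)_{i,k}`, `x_{i,k}` kept by the agents. -/
structure State (n p : ℕ) where
  d : Fin n → EuclideanSpace ℝ (Fin p)
  h : Fin n → EuclideanSpace ℝ (Fin p)
  hw : Fin n → EuclideanSpace ℝ (Fin p)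
  x : Fin n → EuclideanSpace ℝ (Fin p)

/-- Initialization from `x_{i,-1}`, `h_{i,0}`, with stepsize `η_{-1}` and `G i` the noisy gradient
at `x_{i,-1}`. (As `w_{ij} = 0` unless `j` is `i` or a neighbor of `i`, the communication sums run
over all `j`.) -/
noncomputable def initState {n p : ℕ} (W : Matrix (Fin n) (Fin n) ℝ) (η : ℝ)
    (G xinit h0 : Fin n → EuclideanSpace ℝ (Fin p)) : State n p where
  d := fun _ => 0
  h := h0
  hw := fun i => ∑ j, W i j • h0 j
  x := fun i => xinit i - η • G i

/-- One iteration: `G i` is the noisy gradient at `x_{i,k}` and `Q i` the realization of the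
compression operator used by agent `i`. -/
noncomputable def step {n p : ℕ} (W : Matrix (Fin n) (Fin n) ℝ) (α γ η : ℝ)
    (Q : Fin n → EuclideanSpace ℝ (Fin p) → EuclideanSpace ℝ (Fin p))
    (G : Fin n → EuclideanSpace ℝ (Fin p)) (s : State n p) : State n p :=
  let y := fun i => s.x i - η • G i - s.d i
  let q := fun i => Q i (y i - s.h i)
  let yhat := fun i => s.h i + q i
  let yhatw := fun i => s.hw i + ∑ j, W i j • q j
  let d' := fun i => s.d i + (γ / 2) • (yhat i - yhatw i)
  { d := d'
    h := fun i => (1 - α) • s.h i + α • yhat i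
    hw := fun i => (1 - α) • s.hw i + α • yhatw i
    x := fun i => s.x i - η • G i - d' i }

/-- The CEDAS algorithm: `cedas … k ω` is the state with index `k = 0, 1, …`. The stepsizes and
the gradient samples are indexed with a shift by one: `η 0`, `ξ i 0` stand for `η_{-1}`,
`ξ_{i,-1}`, and `η (k + 1)`, `ξ i (k + 1)` for `η_k`, `ξ_{i,k}`. -/
noncomputable def cedas {n p : ℕ} {Ω Ξ Z : Type*} (W : Matrix (Fin n) (Fin n) ℝ) (α γ : ℝ)
    (η : ℕ → ℝ) (g : Fin n → EuclideanSpace ℝ (Fin p) → Ξ → EuclideanSpace ℝ (Fin p))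
    (ξ : Fin n → ℕ → Ω → Ξ) (𝒞 : EuclideanSpace ℝ (Fin p) → Z → EuclideanSpace ℝ (Fin p))
    (ζ : Fin n → ℕ → Ω → Z) (xinit h0 : Fin n → EuclideanSpace ℝ (Fin p)) :
    ℕ → Ω → State n p
  | 0, ω => initState W (η 0) (fun i => g i (xinit i) (ξ i 0 ω)) xinit h0
  | k + 1, ω =>
    let s := cedas W α γ η g ξ 𝒞 ζ xinit h0 k ω
    step W α γ (η (k + 1)) (fun i v => 𝒞 v (ζ i k ω))
      (fun i => g i (s.x i) (ξ i (k + 1) ω)) s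

/-- `(1/K) ∑_{t<K} 𝔼‖∇f(x̄_t)‖² ≤ A / √(nK)`, with finite expectations, for the iterates
`x t ω : Fin n → ℝᵖ`. -/
def HasCentralizedRate {n p : ℕ} {Ω : Type*} [MeasurableSpace Ω] (P : Measure Ω)
    (f : Fin n → EuclideanSpace ℝ (Fin p) → ℝ) (A : ℝ) (K : ℕ)
    (x : ℕ → Ω → Fin n → EuclideanSpace ℝ (Fin p)) : Prop :=
  (∀ t < K, Integrable (fun ω => ‖gradient (objective f) (avg (x t ω))‖ ^ 2) P) ∧
    (K : ℝ)⁻¹ * ∑ t ∈ Finset.range K, ∫ ω, ‖gradient (objective f) (avg (x t ω))‖ ^ 2 ∂P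
      ≤ A / Real.sqrt (n * K)

/-- `T` is the transient time with rate constant `A` of the family of runs `x`, where `x K` is the
run with iteration number (horizon) `K` and only horizons `K ≥ K₀` are admitted: the least
`K ≥ K₀` such that the run with horizon `k` has the centralized rate for every `k ≥ K`. -/
def IsTransientTime {n p : ℕ} {Ω : Type*} [MeasurableSpace Ω] (P : Measure Ω)
    (f : Fin n → EuclideanSpace ℝ (Fin p) → ℝ) (A K₀ : ℝ)
    (x : ℕ → ℕ → Ω → Fin n → EuclideanSpace ℝ (Fin p)) (T : ℕ) : Prop :=
  IsLeast {K : ℕ | K₀ ≤ K ∧ ∀ k ≥ K, HasCentralizedRate P f A k (x k)} T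

end CEDAS

/-! Since `C = 0`, the compressor is almost surely the identity at every point the algorithm feeds
it, so the run coincides with an exact one. There `hw = W h`, and with `α = 1`, `γ = 1/2` the
recursion becomes `x' = (3 + W)/4 y`, `d' = d + (1 - W)/4 y`, where `y = x - η G - d`.

Put `β = 1 - λ₂` and let `z` have rows `d i + η ∇f i(x̄)`. On an eigenmode of `W` with eigenvalue
`m` and `ρ = (3 + m)/4`, up to noise, the Lipschitz perturbation and the drift of `∇f i(x̄)`, the
pair `(x, z)` goes to `(ρ(x - z), (1 - ρ)x + ρz)`. In the norm `‖x‖² + ρ/(1 - ρ) ‖z‖²` the cross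
terms cancel and the square of the norm is multiplied by exactly `ρ ≤ 1 - β/4` (`mode_step_eq`). The
stepsize condition `512 (ηL)² ≤ β²` lets the perturbations cost only part of this gap, so the mean
energy contracts by `1 - β/16` per step, up to `η² n σ²` and a drift term of order `n L² η⁴/β²`
times the squared averaged gradient (`IsNoise.integral_energy_step`).

The mean iterate performs a noisy gradient step, because `∑ d i = 0` is preserved. Its descent
inequality loses `L²/n` times the consensus error, which the energy dominates, and gains `(1 - ηL)`
times the squared averaged gradient, which pays for the drift (`IsRun.sum_gradient_le`).
Independence across agents divides the variance of the averaged noise by `n`.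

With `η = √(n/K)` the centralized terms are of order `1/√(nK)`, and every other term is at most a
constant times `n/(Kβ)`. That is below `1/√(nK)` once `K` exceeds a constant times `n³/β²`
(`IsRun.rate`). The initial energy brings no additional power of `1/β`, because the dual weight
`4/β` comes with a factor `η²` (`IsRun.meanEnergy_zero_le`). -/

namespace CEDAS

/-! ### Spectrum of the mixing matrix. -/

section Spectral

variable {n : ℕ} {G : SimpleGraph (Fin n)} {W : Matrix (Fin n) (Fin n) ℝ}

/-- The `u a` form an orthonormal basis of eigenvectors of `W` with eigenvalues `μ a`; the
mode `a₀` is the consensus mode, and the other eigenvalues are at most `ν`. -/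
structure IsModeSystem (W : Matrix (Fin n) (Fin n) ℝ) (ν : ℝ) (u : Fin n → Fin n → ℝ)
    (μ : Fin n → ℝ) (a₀ : Fin n) : Prop where
  eigen : ∀ a i, ∑ j, W i j * u a j = μ a * u a i
  complete : ∀ i j, ∑ a, u a i * u a j = if i = j then 1 else 0
  const : ∀ i j, u a₀ i = u a₀ j
  sum_eq_zero : ∀ a, a ≠ a₀ → ∑ i, u a i = 0
  le : ∀ a, a ≠ a₀ → μ a ≤ ν
  neg_one_le : ∀ a, -1 ≤ μ a

theorem IsMixingMatrix.symm_apply (hW : IsMixingMatrix G W) (i j : Fin n) : W i j = W j i := by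
  have := hW.symm.apply j i
  simpa using this

theorem IsMixingMatrix.col_sum (hW : IsMixingMatrix G W) (j : Fin n) : ∑ i, W i j = 1 := by
  simp_rw [hW.symm_apply _ j, hW.stochastic]

/-- Expanding the square, rows and columns of `W` sum to one. The sign `s = 1` gives the Dirichlet
form, hence `m ≤ 1`; `s = -1` gives `-1 ≤ m`. -/
theorem IsMixingMatrix.sum_sq_sub (hW : IsMixingMatrix G W) {v : Fin n → ℝ} {m : ℝ}
    (hv : ∀ i, ∑ j, W i j * v j = m * v i) (s : ℝ) (hs : s ^ 2 = 1) :
    ∑ i, ∑ j, W i j * (v i - s * v j) ^ 2 = 2 * (1 - s * m) * ∑ i, v i ^ 2 := by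
  have h1 : ∑ i, ∑ j, W i j * v i ^ 2 = ∑ i, v i ^ 2 := by
    simp_rw [← Finset.sum_mul, hW.stochastic, one_mul]
  have h2 : ∑ i, ∑ j, W i j * v j ^ 2 = ∑ i, v i ^ 2 := by
    rw [Finset.sum_comm]
    simp_rw [← Finset.sum_mul, hW.col_sum, one_mul]
  have h3 : ∑ i, ∑ j, v i * (W i j * v j) = m * ∑ i, v i ^ 2 := by
    simp_rw [← Finset.mul_sum, hv]
    rw [Finset.mul_sum]
    exact Finset.sum_congr rfl fun i _ => by ring
  have h4 : ∀ i j, W i j * (v i - s * v j) ^ 2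
      = W i j * v i ^ 2 + W i j * v j ^ 2 - 2 * s * (v i * (W i j * v j)) := by
    intro i j
    linear_combination (W i j * v j ^ 2) * hs
  have h5 : ∑ i, ∑ j, W i j * (v i - s * v j) ^ 2 = ∑ i, ∑ j, W i j * v i ^ 2
      + ∑ i, ∑ j, W i j * v j ^ 2 - 2 * s * ∑ i, ∑ j, v i * (W i j * v j) := by
    simp only [h4, Finset.sum_sub_distrib, Finset.sum_add_distrib]
    simp only [Finset.mul_sum]
  rw [h5, h1, h2, h3]
  ring

theorem IsMixingMatrix.eigenvalue_bounds (hW : IsMixingMatrix G W) {v : Fin n → ℝ} {m : ℝ}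
    (hv : ∀ i, ∑ j, W i j * v j = m * v i) (h1 : ∑ i, v i ^ 2 = 1) : -1 ≤ m ∧ m ≤ 1 := by
  have h : ∀ s : ℝ, 0 ≤ ∑ i, ∑ j, W i j * (v i - s * v j) ^ 2 := fun s =>
    Finset.sum_nonneg fun i _ => Finset.sum_nonneg fun j _ =>
      mul_nonneg (hW.nonneg i j) (sq_nonneg _)
  have hp := h 1
  have hm := h (-1)
  rw [hW.sum_sq_sub hv _ (by norm_num), h1] at hp hm
  constructor <;> linarith

/-- The Dirichlet form of a fixed vector vanishes, so the vector agrees across every edge, and the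
graph is connected. -/
theorem IsMixingMatrix.const_of_fixed (hW : IsMixingMatrix G W) {v : Fin n → ℝ}
    (hv : ∀ i, ∑ j, W i j * v j = v i) (i j : Fin n) : v i = v j := by
  have h := hW.sum_sq_sub (m := 1) (by simpa using hv) 1 (by norm_num)
  simp only [mul_one, sub_self, one_mul, mul_zero, zero_mul] at h
  have hnn : ∀ i j, 0 ≤ W i j * (v i - v j) ^ 2 := fun i j =>
    mul_nonneg (hW.nonneg i j) (sq_nonneg _)
  have hadj : ∀ a b, G.Adj a b → v a = v b := by
    intro a b hab
    have h1 := (Finset.sum_eq_zero_iff_of_nonneg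
      (fun i _ => Finset.sum_nonneg fun j _ => hnn i j)).1 h a (Finset.mem_univ _)
    have h2 := (Finset.sum_eq_zero_iff_of_nonneg (fun j _ => hnn a j)).1 h1 b (Finset.mem_univ _)
    have h3 := (mul_eq_zero.1 h2).resolve_left (hW.pos_of_adj a b hab).ne'
    exact sub_eq_zero.1 (pow_eq_zero_iff two_ne_zero |>.1 h3)
  obtain ⟨w⟩ := hW.connected.preconnected i j
  induction w with
  | nil => rfl
  | cons hab _ ih => exact (hadj _ _ hab).trans ih

theorem IsMixingMatrix.exists_modeSystem (hW : IsMixingMatrix G W) (hn : 2 ≤ n) :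
    lambda2 hn hW.symm < 1 ∧ -1 ≤ lambda2 hn hW.symm ∧
      ∃ u μ a₀, IsModeSystem W (lambda2 hn hW.symm) u μ a₀ := by
  classical
  let U := hW.symm.eigenvectorBasis
  let u : Fin n → Fin n → ℝ := fun a i => U a i
  let μ := hW.symm.eigenvalues
  -- This is the reindexing inside the definition of `eigenvalues`, so `hμ` holds by `rfl`; `a₀` and
  -- `a₁` carry the largest and second largest eigenvalue.
  let e : Fin n ≃ Fin (Fintype.card (Fin n)) :=
    (Fintype.equivOfCardEq (Fintype.card_fin _)).symm
  have hμ : ∀ a, μ a = hW.symm.eigenvalues₀ (e a) := fun a => rfl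
  have hcard : Fintype.card (Fin n) = n := Fintype.card_fin n
  let a₀ : Fin n := e.symm ⟨0, by omega⟩
  let a₁ : Fin n := e.symm ⟨1, by omega⟩
  have hne : a₁ ≠ a₀ := by
    intro h
    have := e.symm.injective h
    simp at this
  have hlam : lambda2 hn hW.symm = μ a₁ := by
    rw [hμ]; simp [a₁, lambda2]
  have heig : ∀ a i, ∑ j, W i j * u a j = μ a * u a i := by
    intro a i
    have := congrFun (hW.symm.mulVec_eigenvectorBasis a) i
    simpa [Matrix.mulVec, dotProduct] using this
  have horth : ∀ a b, ∑ i, u a i * u b i = if a = b then 1 else 0 := by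
    intro a b
    have := orthonormal_iff_ite.1 U.orthonormal a b
    rw [← this, PiLp.inner_apply]
    exact Finset.sum_congr rfl fun i _ => by simp [u, mul_comm]
  have hcompl : ∀ i j, ∑ a, u a i * u a j = if i = j then 1 else 0 := by
    have hM : (Matrix.of u) * (Matrix.of u).transpose = 1 := by
      ext a b
      simp [Matrix.mul_apply, horth, Matrix.one_apply]
    have hM' := mul_eq_one_comm.1 hM
    intro i j
    have := congrFun (congrFun hM' i) j
    simpa [Matrix.mul_apply, Matrix.one_apply] using this
  have hsq : ∀ a, ∑ i, u a i ^ 2 = 1 := by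
    intro a
    have := horth a a
    simpa [sq] using this
  have hb : ∀ a, -1 ≤ μ a ∧ μ a ≤ 1 := fun a => hW.eigenvalue_bounds (heig a) (hsq a)
  have hle : ∀ a, a ≠ a₀ → μ a ≤ μ a₁ := by
    intro a ha
    rw [hμ, hμ]
    apply hW.symm.eigenvalues₀_antitone
    have h1 : e a ≠ ⟨0, by omega⟩ := by
      intro h
      exact ha ((Equiv.eq_symm_apply e).2 h)
    have h2 : (e a : ℕ) ≠ 0 := fun h => h1 (Fin.ext h)
    simp only [a₁, Equiv.apply_symm_apply, Fin.le_def]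
    omega
  have hzero : ∀ a, μ a ≠ 1 → ∑ i, u a i = 0 := by
    intro a ha
    have h1 : ∑ i, ∑ j, W i j * u a j = ∑ j, u a j := by
      rw [Finset.sum_comm]
      simp_rw [← Finset.sum_mul, hW.col_sum, one_mul]
    simp_rw [heig, ← Finset.mul_sum] at h1
    have h2 : (μ a - 1) * ∑ i, u a i = 0 := by linarith
    exact (mul_eq_zero.1 h2).resolve_left (sub_ne_zero.2 ha)
  have hconst1 : ∀ a, μ a = 1 → ∀ i j, u a i = u a j := by
    intro a ha
    exact hW.const_of_fixed (fun i => by rw [heig, ha, one_mul])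
  have h10 : μ a₁ ≤ μ a₀ := by
    rw [hμ, hμ]
    apply hW.symm.eigenvalues₀_antitone
    simp [a₀, Fin.le_def]
  have hn0 : 0 < n := by omega
  -- Were the second eigenvalue `1`, the first would be too, and two orthonormal eigenvectors would
  -- both be constant.
  have hlt : μ a₁ < 1 := by
    refine lt_of_le_of_ne (hb a₁).2 fun h1 => ?_
    have h0 : μ a₀ = 1 := le_antisymm (hb a₀).2 (h1 ▸ h10)
    have c1 := hconst1 _ h1
    have c0 := hconst1 _ h0
    have o := horth a₁ a₀
    rw [if_neg hne] at o
    let i₀ : Fin n := ⟨0, hn0⟩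
    have s1 := hsq a₁
    have s0 := hsq a₀
    simp_rw [fun i => c1 i i₀, fun i => c0 i i₀] at o s1 s0
    simp only [Finset.sum_const, Finset.card_univ, hcard, nsmul_eq_mul] at o s1 s0
    have hnn : (n : ℝ) ≠ 0 := by positivity
    rcases mul_eq_zero.1 ((mul_eq_zero.1 o).resolve_left hnn) with h | h
    · simp [h] at s1
    · simp [h] at s0
  have hz : ∀ a, a ≠ a₀ → ∑ i, u a i = 0 := fun a ha => hzero a ((hle a ha).trans_lt hlt).ne
  -- Summing the completeness relation over `j` leaves only the mode `a₀`, since all others have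
  -- zero sum; this makes `u a₀` constant without computing `μ a₀`.
  have hc0 : ∀ i, u a₀ i * ∑ j, u a₀ j = 1 := by
    intro i
    have h1 : ∑ j, ∑ a, u a i * u a j = 1 := by
      simp_rw [hcompl]; simp
    rw [Finset.sum_comm] at h1
    simp_rw [← Finset.mul_sum] at h1
    rwa [Finset.sum_eq_single a₀ (fun a _ ha => by rw [hz a ha, mul_zero])
      (fun h => absurd (Finset.mem_univ _) h)] at h1
  refine ⟨hlam ▸ hlt, hlam ▸ (hb a₁).1, u, μ, a₀, heig, hcompl, ?_, hz,
    fun a ha => hlam ▸ hle a ha, fun a => (hb a).1⟩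
  intro i j
  have hs : ∑ j, u a₀ j ≠ 0 := fun h => by simpa [h] using hc0 i
  exact mul_right_cancel₀ hs ((hc0 i).trans (hc0 j).symm)

end Spectral

end CEDAS

namespace CEDAS

open scoped InnerProductSpace

/-! ### Contraction of the energy along a single path. -/

section Modes

theorem norm_add_sq_le_young {V : Type*} [SeminormedAddCommGroup V] (v w : V) {ε : ℝ} (hε : 0 < ε) :
    ‖v + w‖ ^ 2 ≤ (1 + ε) * ‖v‖ ^ 2 + (1 + 1 / ε) * ‖w‖ ^ 2 := by
  have h1 : ‖v + w‖ ^ 2 ≤ (‖v‖ + ‖w‖) ^ 2 :=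
    pow_le_pow_left₀ (norm_nonneg _) (norm_add_le v w) 2
  have h2 : 2 * ‖v‖ * ‖w‖ ≤ ε * ‖v‖ ^ 2 + 1 / ε * ‖w‖ ^ 2 := by
    have h3 : ε * ‖v‖ ^ 2 + 1 / ε * ‖w‖ ^ 2 - 2 * ‖v‖ * ‖w‖ = (ε * ‖v‖ - ‖w‖) ^ 2 / ε := by
      field_simp
      ring
    have : 0 ≤ (ε * ‖v‖ - ‖w‖) ^ 2 / ε := by positivity
    linarith
  nlinarith

variable {n : ℕ} {V : Type*} [NormedAddCommGroup V] [InnerProductSpace ℝ V]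

/-- The coefficient of the stacked vector `x` along the mode `u a`. -/
def coef (u : Fin n → Fin n → ℝ) (a : Fin n) (x : Fin n → V) : V := ∑ i, u a i • x i

variable {W : Matrix (Fin n) (Fin n) ℝ} {ν : ℝ} {u : Fin n → Fin n → ℝ} {μ : Fin n → ℝ}
  {a₀ : Fin n}

theorem coef_add (a : Fin n) (x y : Fin n → V) :
    coef u a (fun i => x i + y i) = coef u a x + coef u a y := by
  simp [coef, smul_add, Finset.sum_add_distrib]

theorem coef_sub (a : Fin n) (x y : Fin n → V) :
    coef u a (fun i => x i - y i) = coef u a x - coef u a y := by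
  simp [coef, smul_sub, Finset.sum_sub_distrib]

theorem coef_smul (a : Fin n) (c : ℝ) (x : Fin n → V) :
    coef u a (fun i => c • x i) = c • coef u a x := by
  simp only [coef, Finset.smul_sum]
  exact Finset.sum_congr rfl fun i _ => smul_comm _ _ _

theorem IsModeSystem.sum_inner_coef (h : IsModeSystem W ν u μ a₀) (x y : Fin n → V) :
    ∑ a, ⟪coef u a x, coef u a y⟫_ℝ = ∑ i, ⟪x i, y i⟫_ℝ := by
  have h1 : ∀ a, ⟪coef u a x, coef u a y⟫_ℝ = ∑ i, ∑ j, (u a i * u a j) * ⟪x i, y j⟫_ℝ := by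
    intro a
    simp only [coef, sum_inner, inner_sum, real_inner_smul_left, real_inner_smul_right]
    rw [Finset.sum_comm]
    exact Finset.sum_congr rfl fun i _ => Finset.sum_congr rfl fun j _ => by ring
  simp_rw [h1]
  rw [Finset.sum_comm]
  refine Finset.sum_congr rfl fun i _ => ?_
  rw [Finset.sum_comm]
  simp_rw [← Finset.sum_mul, h.complete]
  simp

theorem IsModeSystem.sum_norm_coef (h : IsModeSystem W ν u μ a₀) (x : Fin n → V) :
    ∑ a, ‖coef u a x‖ ^ 2 = ∑ i, ‖x i‖ ^ 2 := by
  simpa [real_inner_self_eq_norm_sq] using h.sum_inner_coef x x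

theorem IsModeSystem.sum_erase_norm_coef_le (h : IsModeSystem W ν u μ a₀) (x : Fin n → V) :
    ∑ a ∈ Finset.univ.erase a₀, ‖coef u a x‖ ^ 2 ≤ ∑ i, ‖x i‖ ^ 2 := by
  rw [← h.sum_norm_coef]
  exact Finset.sum_le_sum_of_subset_of_nonneg (Finset.erase_subset _ _)
    fun _ _ _ => sq_nonneg _

theorem smul_avg (hn : n ≠ 0) (x : Fin n → V) : (n : ℝ) • avg x = ∑ i, x i := by
  rw [avg, smul_smul, mul_inv_cancel₀ (Nat.cast_ne_zero.2 hn), one_smul]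

/-- Subtracting the average kills the consensus coefficient and leaves the others unchanged; then
Parseval. -/
theorem IsModeSystem.sum_norm_sub_avg (h : IsModeSystem W ν u μ a₀) (hn : n ≠ 0)
    (x : Fin n → V) :
    ∑ i, ‖x i - avg x‖ ^ 2 = ∑ a ∈ Finset.univ.erase a₀, ‖coef u a x‖ ^ 2 := by
  rw [← h.sum_norm_coef, ← Finset.add_sum_erase _ _ (Finset.mem_univ a₀)]
  have h0 : coef u a₀ (fun i => x i - avg x) = 0 := by
    have h1 : ∑ i, (x i - avg x) = 0 := by
      rw [Finset.sum_sub_distrib, ← smul_avg hn x, Finset.sum_const, Finset.card_univ,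
        Fintype.card_fin, ← Nat.cast_smul_eq_nsmul ℝ, sub_self]
    simp only [coef]
    simp_rw [fun i => h.const i a₀, ← Finset.smul_sum, h1, smul_zero]
  rw [h0, norm_zero, zero_pow two_ne_zero, zero_add]
  refine Finset.sum_congr rfl fun a ha => ?_
  rw [coef_sub]
  have : coef u a (fun _ : Fin n => avg x) = 0 := by
    simp only [coef, ← Finset.sum_smul, h.sum_eq_zero a (Finset.ne_of_mem_erase ha), zero_smul]
  rw [this, sub_zero]

theorem IsModeSystem.coef_mul (h : IsModeSystem W ν u μ a₀) (hs : ∀ i j, W i j = W j i)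
    (a : Fin n) (y : Fin n → V) :
    coef u a (fun i => ∑ j, W i j • y j) = μ a • coef u a y := by
  simp only [coef, Finset.smul_sum]
  rw [Finset.sum_comm]
  refine Finset.sum_congr rfl fun i _ => ?_
  rw [smul_smul, ← h.eigen, Finset.sum_smul]
  refine Finset.sum_congr rfl fun j _ => ?_
  rw [smul_smul, hs i j, mul_comm]

/-- The weight `ρ / (1 - ρ)` with `ρ = (3 + m) / 4`. -/
noncomputable def dualWeight (m : ℝ) : ℝ := (3 + m) / (1 - m)

/-- The Lyapunov function: on each non-consensus mode the matrix of the recursion is a multiple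
of an isometry in this norm. -/
noncomputable def energy (u : Fin n → Fin n → ℝ) (μ : Fin n → ℝ) (a₀ : Fin n)
    (x z : Fin n → V) : ℝ :=
  ∑ a ∈ Finset.univ.erase a₀, (‖coef u a x‖ ^ 2 + dualWeight (μ a) * ‖coef u a z‖ ^ 2)

/-- One step of one mode, without drift. -/
theorem mode_step_eq (m : ℝ) (hm : m < 1) (r z : V) :
    ‖((3 + m) / 4) • (r - z)‖ ^ 2
        + dualWeight m * ‖z + ((1 - m) / 4) • (r - z)‖ ^ 2
      = (3 + m) / 4 * (‖r‖ ^ 2 + dualWeight m * ‖z‖ ^ 2) := by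
  have h1 : (1 - m) ≠ 0 := by linarith
  -- With `ρ = (3 + m)/4` the second vector is `(1 - ρ) r + ρ z`, and the weight satisfies
  -- `dualWeight m * (1 - ρ) = ρ`, so the cross terms cancel.
  rw [norm_smul, norm_add_sq_real, norm_smul, real_inner_smul_right, inner_sub_right,
    real_inner_self_eq_norm_sq, mul_pow, mul_pow, norm_sub_sq_real, Real.norm_eq_abs,
    Real.norm_eq_abs, sq_abs, sq_abs, dualWeight, real_inner_comm z r]
  field_simp
  ring

theorem dualWeight_nonneg {m : ℝ} (h : -1 ≤ m) (h1 : m < 1) : 0 ≤ dualWeight m :=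
  div_nonneg (by linarith) (by linarith)

theorem dualWeight_le {m β : ℝ} (h1 : m ≤ 1 - β) (hβ : 0 < β) :
    dualWeight m ≤ 4 / β := by
  rw [dualWeight, div_le_div_iff₀ (by linarith) hβ]
  nlinarith

/-- Young's inequality with `ε = β/16` separates the drift `e`; its coefficient is at most `(4/β)(1
+ 16/β) ≤ (4/β)(18/β)`. -/
theorem mode_step_le {m β : ℝ} (hm : -1 ≤ m) (hβ : 0 < β) (hβ2 : β ≤ 2) (hmβ : m ≤ 1 - β)
    (r z e : V) :
    ‖((3 + m) / 4) • (r - z)‖ ^ 2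
        + dualWeight m * ‖z + ((1 - m) / 4) • (r - z) + e‖ ^ 2
      ≤ (1 + β / 16) * (1 - β / 4) * (‖r‖ ^ 2 + dualWeight m * ‖z‖ ^ 2)
        + 72 / β ^ 2 * ‖e‖ ^ 2 := by
  have hm1 : m < 1 := by linarith
  have hκ := dualWeight_nonneg hm hm1
  have hκ' := dualWeight_le hmβ hβ
  have h0 := mode_step_eq m hm1 r z
  have h1 := norm_add_sq_le_young (z + ((1 - m) / 4) • (r - z)) e (ε := β / 16) (by positivity)
  set A := ‖((3 + m) / 4) • (r - z)‖ ^ 2 with hA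
  set B := ‖z + ((1 - m) / 4) • (r - z)‖ ^ 2 with hB
  have hA0 : 0 ≤ A := sq_nonneg _
  have hX : 0 ≤ ‖r‖ ^ 2 + dualWeight m * ‖z‖ ^ 2 := by positivity
  calc A + dualWeight m * ‖z + ((1 - m) / 4) • (r - z) + e‖ ^ 2
      ≤ (1 + β / 16) * A + dualWeight m * ((1 + β / 16) * B + (1 + 1 / (β / 16)) * ‖e‖ ^ 2) := by
        gcongr
        have : 0 ≤ β / 16 * A := by positivity
        linarith
    _ = (1 + β / 16) * ((3 + m) / 4 * (‖r‖ ^ 2 + dualWeight m * ‖z‖ ^ 2))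
        + dualWeight m * (1 + 1 / (β / 16)) * ‖e‖ ^ 2 := by
        rw [← h0]; ring
    _ ≤ (1 + β / 16) * ((1 - β / 4) * (‖r‖ ^ 2 + dualWeight m * ‖z‖ ^ 2))
        + (4 / β) * (18 / β) * ‖e‖ ^ 2 := by
        have h18 : 1 + 1 / (β / 16) ≤ 18 / β := by
          rw [← sub_nonneg]
          have : 18 / β - (1 + 1 / (β / 16)) = (2 - β) / β := by field_simp; ring
          rw [this]; exact div_nonneg (by linarith) hβ.le
        gcongr
        linarith
    _ = _ := by ring

/-- Used with `τ = η L`. As `22² < 512`, the hypothesis gives `τ ≤ β/22`, so neither Young's factor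
nor the Lipschitz factor `(1 + τ)²` exhausts the gap `β/4`. -/
theorem rate_le {τ β : ℝ} (hτ : 0 ≤ τ) (hβ : 0 < β) (hβ2 : β ≤ 2) (h : 512 * τ ^ 2 ≤ β ^ 2) :
    (1 + β / 16) * (1 - β / 4) * (1 + τ) ^ 2 ≤ 1 - β / 16 := by
  have h1 : τ ≤ β / 22 := by
    rw [← abs_of_nonneg hτ, ← abs_of_nonneg (show 0 ≤ β / 22 by positivity)]
    apply sq_le_sq.1
    nlinarith
  have h2 : (1 + τ) ^ 2 ≤ 1 + β / 10 := by nlinarith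
  have h3 : (1 + β / 16) * (1 - β / 4) ≤ 1 - 3 / 16 * β := by nlinarith
  have h4 : 0 ≤ 1 - 3 / 16 * β := by linarith
  calc (1 + β / 16) * (1 - β / 4) * (1 + τ) ^ 2 ≤ (1 - 3 / 16 * β) * (1 + β / 10) := by gcongr
    _ ≤ 1 - β / 16 := by nlinarith

variable {gr : Fin n → V → V} {L η : ℝ}

theorem avg_sub (x y : Fin n → V) : avg (fun i => x i - y i) = avg x - avg y := by
  simp [avg, Finset.sum_sub_distrib, smul_sub]

theorem avg_smul (c : ℝ) (x : Fin n → V) : avg (fun i => c • x i) = c • avg x := by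
  simp only [avg, ← Finset.smul_sum]
  exact smul_comm _ _ _

theorem sum_mul_eq (hcol : ∀ j, ∑ i, W i j = 1) (y : Fin n → V) :
    ∑ i, ∑ j, W i j • y j = ∑ j, y j := by
  rw [Finset.sum_comm]
  simp_rw [← Finset.sum_smul, hcol, one_smul]

/-- The stacked vector `x - η (∇F(x) - ∇F(x̄))`. -/
noncomputable def meanStep (gr : Fin n → V → V) (η : ℝ) (x : Fin n → V) (i : Fin n) : V :=
  x i - η • (gr i (x i) - gr i (avg x))

/-- The projection of `meanStep` to the non-consensus modes. -/
noncomputable def projStep (u : Fin n → Fin n → ℝ) (a₀ : Fin n) (gr : Fin n → V → V) (η : ℝ)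
    (x : Fin n → V) (i : Fin n) : V :=
  ∑ a ∈ Finset.univ.erase a₀, u a i • coef u a (meanStep gr η x)

theorem IsModeSystem.sum_norm_gr_sub_le (h : IsModeSystem W ν u μ a₀) (hn : n ≠ 0)
    (hgr : ∀ i x y, ‖gr i x - gr i y‖ ≤ L * ‖x - y‖) (x : Fin n → V) :
    ∑ i, ‖gr i (x i) - gr i (avg x)‖ ^ 2
      ≤ L ^ 2 * ∑ a ∈ Finset.univ.erase a₀, ‖coef u a x‖ ^ 2 := by
  rw [← h.sum_norm_sub_avg hn, Finset.mul_sum]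
  refine Finset.sum_le_sum fun i _ => ?_
  rw [← mul_pow]
  exact pow_le_pow_left₀ (norm_nonneg _) (hgr i _ _) 2

/-- Young with `ε = ηL` on each mode, then Parseval and the Lipschitz bound on the gradient
differences: `(1 + ηL) + (1 + 1/(ηL)) (ηL)² = (1 + ηL)²`. -/
theorem IsModeSystem.sum_norm_coef_meanStep_le (h : IsModeSystem W ν u μ a₀) (hn : n ≠ 0)
    (hL : 0 < L) (hη : 0 < η) (hgr : ∀ i x y, ‖gr i x - gr i y‖ ≤ L * ‖x - y‖)
    (x : Fin n → V) :
    ∑ a ∈ Finset.univ.erase a₀, ‖coef u a (meanStep gr η x)‖ ^ 2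
      ≤ (1 + η * L) ^ 2 * ∑ a ∈ Finset.univ.erase a₀, ‖coef u a x‖ ^ 2 := by
  set b : Fin n → V := fun i => gr i (x i) - gr i (avg x) with hb
  have hS := h.sum_norm_gr_sub_le hn hgr x
  have hb1 := h.sum_erase_norm_coef_le b
  have h1 : ∀ a, ‖coef u a (meanStep gr η x)‖ ^ 2
      ≤ (1 + η * L) * ‖coef u a x‖ ^ 2 + (1 + 1 / (η * L)) * η ^ 2 * ‖coef u a b‖ ^ 2 := by
    intro a
    have h2 : coef u a (meanStep gr η x) = coef u a x + (-η) • coef u a b := by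
      rw [show meanStep gr η x = fun i => x i - η • b i from rfl, coef_sub, coef_smul, neg_smul,
        sub_eq_add_neg]
    have h3 := norm_add_sq_le_young (coef u a x) ((-η) • coef u a b) (mul_pos hη hL)
    rw [← h2, norm_smul, mul_pow, Real.norm_eq_abs, sq_abs] at h3
    linarith [h3]
  refine (Finset.sum_le_sum fun a _ => h1 a).trans ?_
  rw [Finset.sum_add_distrib, ← Finset.mul_sum, ← Finset.mul_sum]
  have h4 : (1 + 1 / (η * L)) * η ^ 2 * ∑ a ∈ Finset.univ.erase a₀, ‖coef u a b‖ ^ 2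
      ≤ (1 + 1 / (η * L)) * η ^ 2 *
        (L ^ 2 * ∑ a ∈ Finset.univ.erase a₀, ‖coef u a x‖ ^ 2) := by
    gcongr
    exact hb1.trans hS
  have h5 : (1 + 1 / (η * L)) * η ^ 2 *
        (L ^ 2 * ∑ a ∈ Finset.univ.erase a₀, ‖coef u a x‖ ^ 2)
      = ((η * L) ^ 2 + η * L) * ∑ a ∈ Finset.univ.erase a₀, ‖coef u a x‖ ^ 2 := by
    field_simp
  rw [h5] at h4
  linarith

/-- One step of the recursion decreases the energy up to noise and drift. -/
theorem IsModeSystem.energy_step (h : IsModeSystem W ν u μ a₀) (hn : n ≠ 0)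
    (hs : ∀ i j, W i j = W j i) (hβ : 0 < 1 - ν) (hν : -1 ≤ ν)
    (hL : 0 < L) (hη : 0 < η) (hgr : ∀ i x y, ‖gr i x - gr i y‖ ≤ L * ‖x - y‖)
    (hτ : 512 * (η * L) ^ 2 ≤ (1 - ν) ^ 2)
    {x d w y x' d' : Fin n → V}
    (hy : ∀ i, y i = x i - η • (gr i (x i) + w i) - d i)
    (hx' : ∀ i, x' i = y i - (1 / 4 : ℝ) • (y i - ∑ j, W i j • y j))
    (hd' : ∀ i, d' i = d i + (1 / 4 : ℝ) • (y i - ∑ j, W i j • y j)) (x₁ : V) :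
    energy u μ a₀ x' (fun i => d' i + η • gr i x₁)
      ≤ (1 - (1 - ν) / 16) * energy u μ a₀ x (fun i => d i + η • gr i (avg x))
        + (1 + (1 - ν) / 16) * (1 - (1 - ν) / 4) *
          (η ^ 2 * ∑ i, ‖w i‖ ^ 2 - 2 * η * ∑ i, ⟪projStep u a₀ gr η x i, w i⟫_ℝ)
        + 72 / (1 - ν) ^ 2 * (η ^ 2 * ∑ i, ‖gr i x₁ - gr i (avg x)‖ ^ 2) := by
  set β := 1 - ν with hβdef
  have hβ2 : β ≤ 2 := by linarith
  set c : Fin n → V := fun i => gr i (avg x) with hc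
  set δ : Fin n → V := fun i => gr i x₁ - gr i (avg x) with hδ
  set z : Fin n → V := fun i => d i + η • gr i (avg x) with hz
  set z' : Fin n → V := fun i => d' i + η • gr i x₁ with hz'
  -- Adding `η ∇f i(x̄)` to `d` and subtracting it from the gradient leaves `y = r - z`, where the
  -- non-noise part of `r` differs from `x` only by a multiple of the consensus error.
  set r : Fin n → V := fun i => meanStep gr η x i - η • w i with hr
  have hyr : ∀ a, coef u a y = coef u a r - coef u a z := by
    intro a
    rw [← coef_sub]
    congr 1
    funext i
    rw [hy]
    simp only [hr, hz, meanStep, smul_add, smul_sub]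
    abel
  have hmix : ∀ a, coef u a (fun i => (1 / 4 : ℝ) • (y i - ∑ j, W i j • y j))
      = ((1 - μ a) / 4) • (coef u a r - coef u a z) := by
    intro a
    rw [coef_smul, coef_sub, h.coef_mul hs, ← hyr]
    module
  have hx1 : ∀ a, coef u a x' = ((3 + μ a) / 4) • (coef u a r - coef u a z) := by
    intro a
    rw [funext hx', coef_sub, hmix, hyr]
    module
  have hz1 : ∀ a, coef u a z' = coef u a z + ((1 - μ a) / 4) • (coef u a r - coef u a z)
      + η • coef u a δ := by
    intro a
    rw [← hmix, ← coef_smul, ← coef_add, ← coef_add]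
    congr 1
    funext i
    simp only [hz', hz, hδ, hd', smul_sub]
    abel
  have hmode : ∀ a ∈ Finset.univ.erase a₀,
      ‖coef u a x'‖ ^ 2 + dualWeight (μ a) * ‖coef u a z'‖ ^ 2
      ≤ (1 + β / 16) * (1 - β / 4) * (‖coef u a r‖ ^ 2 + dualWeight (μ a) * ‖coef u a z‖ ^ 2)
        + 72 / β ^ 2 * (η ^ 2 * ‖coef u a δ‖ ^ 2) := by
    intro a ha
    have := mode_step_le (h.neg_one_le a) hβ hβ2
      (by linarith [h.le a (Finset.ne_of_mem_erase ha)]) (coef u a r) (coef u a z)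
      (η • coef u a δ)
    rw [norm_smul η, mul_pow, Real.norm_eq_abs, sq_abs] at this
    rw [hx1, hz1]
    exact this
  have hrn : ∑ a ∈ Finset.univ.erase a₀, ‖coef u a r‖ ^ 2
      ≤ (1 + η * L) ^ 2 * ∑ a ∈ Finset.univ.erase a₀, ‖coef u a x‖ ^ 2
        + (η ^ 2 * ∑ i, ‖w i‖ ^ 2 - 2 * η * ∑ i, ⟪projStep u a₀ gr η x i, w i⟫_ℝ) := by
    have h1 : ∀ a, ‖coef u a r‖ ^ 2 = ‖coef u a (meanStep gr η x)‖ ^ 2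
        + (η ^ 2 * ‖coef u a w‖ ^ 2
          - 2 * η * ⟪coef u a (meanStep gr η x), coef u a w⟫_ℝ) := by
      intro a
      rw [hr, coef_sub, coef_smul, norm_sub_sq_real, norm_smul, real_inner_smul_right, mul_pow,
        Real.norm_eq_abs, sq_abs]
      ring
    -- The noise cross term is rewritten agentwise, against a vector depending only on `x`, so that
    -- it has mean zero later.
    have h2 : ∑ a ∈ Finset.univ.erase a₀, ⟪coef u a (meanStep gr η x), coef u a w⟫_ℝ
        = ∑ i, ⟪projStep u a₀ gr η x i, w i⟫_ℝ := by
      simp only [projStep, sum_inner]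
      rw [Finset.sum_comm]
      refine Finset.sum_congr rfl fun a _ => ?_
      conv_lhs => rw [show coef u a w = ∑ i, u a i • w i from rfl, inner_sum]
      exact Finset.sum_congr rfl fun i _ => by
        rw [real_inner_smul_left, real_inner_smul_right]
    simp_rw [h1, Finset.sum_add_distrib, Finset.sum_sub_distrib, ← Finset.mul_sum, h2]
    have h3 := h.sum_norm_coef_meanStep_le hn hL hη hgr x
    have h4 : η ^ 2 * ∑ a ∈ Finset.univ.erase a₀, ‖coef u a w‖ ^ 2 ≤ η ^ 2 * ∑ i, ‖w i‖ ^ 2 :=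
      mul_le_mul_of_nonneg_left (h.sum_erase_norm_coef_le w) (sq_nonneg _)
    linarith
  have hθ : 0 ≤ (1 + β / 16) * (1 - β / 4) := mul_nonneg (by linarith) (by linarith)
  -- The factor `(1 + ηL)²` affects only the `x` part of the energy; the `z` part needs only `hθ'`.
  have hrate := rate_le (mul_pos hη hL).le hβ hβ2 hτ
  have hθ' : (1 + β / 16) * (1 - β / 4) ≤ 1 - β / 16 := by nlinarith
  have hZ : 0 ≤ ∑ a ∈ Finset.univ.erase a₀, dualWeight (μ a) * ‖coef u a z‖ ^ 2 :=
    Finset.sum_nonneg fun a ha => mul_nonneg (dualWeight_nonneg (h.neg_one_le a)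
      (by linarith [h.le a (Finset.ne_of_mem_erase ha)])) (sq_nonneg _)
  have hX : 0 ≤ ∑ a ∈ Finset.univ.erase a₀, ‖coef u a x‖ ^ 2 :=
    Finset.sum_nonneg fun a _ => sq_nonneg _
  have hδ1 := h.sum_erase_norm_coef_le δ
  have hsum := Finset.sum_le_sum hmode
  refine hsum.trans ?_
  rw [Finset.sum_add_distrib, ← Finset.mul_sum, ← Finset.mul_sum, ← Finset.mul_sum,
    Finset.sum_add_distrib]
  have e1 := mul_le_mul_of_nonneg_left hrn hθ
  have e2 := mul_le_mul_of_nonneg_right hrate hX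
  have e3 := mul_le_mul_of_nonneg_right hθ' hZ
  have e4 : 72 / β ^ 2 * (η ^ 2 * ∑ a ∈ Finset.univ.erase a₀, ‖coef u a δ‖ ^ 2)
      ≤ 72 / β ^ 2 * (η ^ 2 * ∑ i, ‖δ i‖ ^ 2) := by gcongr
  rw [energy, Finset.sum_add_distrib, mul_add (1 - β / 16)]
  rw [mul_add] at e1 ⊢
  linarith

/-- `y - W y` has zero sum because the columns of `W` sum to one, so mixing is invisible to the
averages. -/
theorem sum_avg_of_step (hcol : ∀ j, ∑ i, W i j = 1) {x d G y x' d' : Fin n → V}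
    (hd : ∑ i, d i = 0) (hy : ∀ i, y i = x i - η • G i - d i)
    (hx' : ∀ i, x' i = y i - (1 / 4 : ℝ) • (y i - ∑ j, W i j • y j))
    (hd' : ∀ i, d' i = d i + (1 / 4 : ℝ) • (y i - ∑ j, W i j • y j)) :
    ∑ i, d' i = 0 ∧ avg x' = avg x - η • avg G := by
  have h1 : ∑ i, (y i - ∑ j, W i j • y j) = 0 := by
    rw [Finset.sum_sub_distrib, sum_mul_eq hcol, sub_self]
  constructor
  · simp_rw [hd', Finset.sum_add_distrib, ← Finset.smul_sum, h1, hd]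
    simp
  · rw [← avg_smul, ← avg_sub]
    simp only [avg]
    congr 1
    rw [Finset.sum_congr rfl fun i _ => hx' i, Finset.sum_sub_distrib, ← Finset.smul_sum, h1]
    simp_rw [hy, Finset.sum_sub_distrib, hd, ← Finset.smul_sum]
    simp

end Modes

/-! ### The descent lemma for smooth functions. -/

section Smooth

variable {V : Type*} [NormedAddCommGroup V] [InnerProductSpace ℝ V] [CompleteSpace V]

/-- The function `φ` is chosen so that `φ 1 ≤ φ 0` is the claim; Cauchy–Schwarz and the Lipschitz
bound make its derivative nonpositive on `(0, 1)`. -/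
theorem le_add_inner_gradient_of_lipschitz {f : V → ℝ} {L : ℝ} (hf : Differentiable ℝ f)
    (hL : ∀ x y, ‖gradient f x - gradient f y‖ ≤ L * ‖x - y‖) (x v : V) :
    f (x + v) ≤ f x + ⟪gradient f x, v⟫_ℝ + L / 2 * ‖v‖ ^ 2 := by
  let φ : ℝ → ℝ := fun t => f (x + t • v) - t * ⟪gradient f x, v⟫_ℝ - L / 2 * t ^ 2 * ‖v‖ ^ 2
  have hd : ∀ t, HasDerivAt φ (⟪gradient f (x + t • v), v⟫_ℝ - ⟪gradient f x, v⟫_ℝ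
      - L * t * ‖v‖ ^ 2) t := by
    intro t
    have h1 : HasDerivAt (fun t : ℝ => x + t • v) v t := by
      simpa using ((hasDerivAt_id t).smul_const v).const_add x
    have h2 := ((hf (x + t • v)).hasGradientAt.hasFDerivAt).comp_hasDerivAt t h1
    have h3 := (h2.sub ((hasDerivAt_id t).mul_const ⟪gradient f x, v⟫_ℝ)).sub
      ((((hasDerivAt_id t).pow 2).const_mul (L / 2)).mul_const (‖v‖ ^ 2))
    refine h3.congr_deriv ?_
    simp only [InnerProductSpace.toDual_apply_apply, id_eq, Nat.cast_ofNat, one_mul, mul_one]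
    ring
  have hanti : AntitoneOn φ (Set.Icc 0 1) := by
    refine antitoneOn_of_deriv_nonpos (convex_Icc 0 1)
      (fun t _ => (hd t).continuousAt.continuousWithinAt)
      (fun t _ => (hd t).differentiableAt.differentiableWithinAt) ?_
    intro t ht
    rw [interior_Icc] at ht
    rw [(hd t).deriv, ← inner_sub_left]
    have h1 := real_inner_le_norm (gradient f (x + t • v) - gradient f x) v
    have h2 := hL (x + t • v) x
    rw [add_sub_cancel_left, norm_smul, Real.norm_eq_abs, abs_of_pos ht.1] at h2
    have h3 := mul_le_mul_of_nonneg_right h2 (norm_nonneg v)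
    linarith
  have h := hanti (Set.left_mem_Icc.2 zero_le_one) (Set.right_mem_Icc.2 zero_le_one) zero_le_one
  simp only [φ, one_smul, zero_smul, add_zero, one_mul, zero_mul, one_pow, mul_one,
    zero_pow two_ne_zero, mul_zero, sub_zero] at h
  linarith

end Smooth

/-! ### Descent of the averaged objective. -/

section Objective

variable {n p : ℕ} {L : ℝ} {f : Fin n → EuclideanSpace ℝ (Fin p) → ℝ} {fInf : Fin n → ℝ}

theorem hasGradientAt_objective (hf : ∀ i, Differentiable ℝ (f i))
    (x : EuclideanSpace ℝ (Fin p)) :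
    HasGradientAt (objective f) (avg fun i => gradient (f i) x) x := by
  rw [hasGradientAt_iff_hasFDerivAt]
  have h1 : HasFDerivAt (fun x => ∑ i, f i x)
      (∑ i, InnerProductSpace.toDual ℝ _ (gradient (f i) x)) x :=
    HasFDerivAt.fun_sum fun i _ => ((hf i x).hasGradientAt.hasFDerivAt)
  have h2 := h1.const_mul (n : ℝ)⁻¹
  refine h2.congr_fderiv ?_
  rw [avg, map_smul, map_sum]

theorem norm_avg_sq_le {V : Type*} [NormedAddCommGroup V] [InnerProductSpace ℝ V] (hn : n ≠ 0)
    (v : Fin n → V) : ‖avg v‖ ^ 2 ≤ (n : ℝ)⁻¹ * ∑ i, ‖v i‖ ^ 2 := by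
  have hn' : (0 : ℝ) < n := by positivity
  rw [avg, norm_smul, mul_pow, Real.norm_eq_abs, sq_abs]
  have h1 : ‖∑ i, v i‖ ^ 2 ≤ n * ∑ i, ‖v i‖ ^ 2 := by
    refine (pow_le_pow_left₀ (norm_nonneg _) (norm_sum_le _ _) 2).trans ?_
    simpa using sq_sum_le_card_mul_sum_sq (s := (Finset.univ : Finset (Fin n)))
      (f := fun i => ‖v i‖)
  calc ((n : ℝ)⁻¹) ^ 2 * ‖∑ i, v i‖ ^ 2 ≤ ((n : ℝ)⁻¹) ^ 2 * (n * ∑ i, ‖v i‖ ^ 2) := by gcongr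
    _ = _ := by field_simp

theorem IsSmoothBelow.gradient_objective (h : IsSmoothBelow L f fInf)
    (x : EuclideanSpace ℝ (Fin p)) :
    gradient (objective f) x = avg fun i => gradient (f i) x :=
  (hasGradientAt_objective h.differentiable x).gradient

theorem IsSmoothBelow.objective_step (h : IsSmoothBelow L f fInf) (hn : n ≠ 0)
    (x v : EuclideanSpace ℝ (Fin p)) :
    objective f (x + v) ≤ objective f x + ⟪gradient (objective f) x, v⟫_ℝ
      + L / 2 * ‖v‖ ^ 2 := by
  have hn' : (0 : ℝ) < n := by positivity
  rw [h.gradient_objective, avg, real_inner_smul_left, sum_inner]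
  have h1 := Finset.sum_le_sum fun i (_ : i ∈ Finset.univ) =>
    le_add_inner_gradient_of_lipschitz (h.differentiable i) (h.lipschitz i) x v
  have h2 := mul_le_mul_of_nonneg_left h1 (inv_nonneg.2 hn'.le)
  simp only [Finset.sum_add_distrib, Finset.sum_const, Finset.card_univ, Fintype.card_fin,
    nsmul_eq_mul, mul_add] at h2
  rw [inv_mul_cancel_left₀ hn'.ne'] at h2
  exact h2

theorem IsSmoothBelow.avg_le_objective (h : IsSmoothBelow L f fInf)
    (x : EuclideanSpace ℝ (Fin p)) : avg fInf ≤ objective f x := by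
  rw [avg, objective, smul_eq_mul]
  gcongr with i
  exact h.bounded_below i x

/-- The bias of the averaged gradient is controlled by the consensus error. -/
theorem IsSmoothBelow.norm_gradient_sub_avg_le (h : IsSmoothBelow L f fInf) (hn : n ≠ 0)
    (x : Fin n → EuclideanSpace ℝ (Fin p)) :
    ‖gradient (objective f) (avg x) - avg fun i => gradient (f i) (x i)‖ ^ 2
      ≤ L ^ 2 / n * ∑ i, ‖x i - avg x‖ ^ 2 := by
  rw [h.gradient_objective, ← avg_sub]
  refine (norm_avg_sq_le hn _).trans ?_
  rw [div_eq_inv_mul, mul_assoc, Finset.mul_sum (a := L ^ 2)]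
  gcongr with i
  rw [← mul_pow, norm_sub_rev (x i)]
  exact pow_le_pow_left₀ (norm_nonneg _) (h.lipschitz i _ _) 2

/-- Descent of the objective along a noisy averaged gradient step. -/
theorem IsSmoothBelow.descent (h : IsSmoothBelow L f fInf) (hn : n ≠ 0)
    {η : ℝ} (hη : 0 < η) (x w : Fin n → EuclideanSpace ℝ (Fin p)) :
    objective f (avg x - η • avg fun i => gradient (f i) (x i) + w i)
      ≤ objective f (avg x)
        - η / 2 * ‖gradient (objective f) (avg x)‖ ^ 2
        - η / 2 * (1 - η * L) * ‖avg fun i => gradient (f i) (x i)‖ ^ 2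
        + η * L ^ 2 / (2 * n) * ∑ i, ‖x i - avg x‖ ^ 2
        + L / 2 * η ^ 2 * ‖avg w‖ ^ 2
        - η * ⟪gradient (objective f) (avg x)
            - (η * L) • (avg fun i => gradient (f i) (x i)), avg w⟫_ℝ := by
  set Γ := gradient (objective f) (avg x) with hΓ
  set M := avg fun i => gradient (f i) (x i) with hM
  have hs : (avg fun i => gradient (f i) (x i) + w i) = M + avg w := by
    simp [hM, avg, Finset.sum_add_distrib]
  have h1 := h.objective_step hn (avg x) (-(η • (M + avg w)))
  have h2 := h.norm_gradient_sub_avg_le hn x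
  -- Polarization: `-η⟪Γ, M⟫ = -η/2 ‖Γ‖² - η/2 ‖M‖² + η/2 ‖Γ - M‖²`. The term in `‖M‖²` is kept, as
  -- it must later absorb the drift.
  rw [← hΓ, ← hM, norm_sub_sq_real] at h2
  rw [← hΓ, inner_neg_right, real_inner_smul_right, inner_add_right, norm_neg, norm_smul, mul_pow,
    Real.norm_eq_abs, sq_abs, norm_add_sq_real, ← sub_eq_add_neg] at h1
  rw [hs, inner_sub_left, real_inner_smul_left]
  have h3 := mul_le_mul_of_nonneg_left h2 (show 0 ≤ η / 2 by positivity)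
  have h4 : η / 2 * (L ^ 2 / n * ∑ i, ‖x i - avg x‖ ^ 2)
      = η * L ^ 2 / (2 * n) * ∑ i, ‖x i - avg x‖ ^ 2 := by
    field_simp
  rw [h4] at h3
  linarith

end Objective

end CEDAS

namespace CEDAS

open scoped InnerProductSpace

/-! ### Rearranging independence. -/

section Independence

variable {Ω α β γ : Type*} [MeasurableSpace Ω] [MeasurableSpace α] [MeasurableSpace β]
  [MeasurableSpace γ] {P : Measure Ω} [IsProbabilityMeasure P]

/-- The joint law of the triple is the product of its three marginals, and a product measure may be
reassociated and swapped. -/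
theorem indepFun_prodMk_of_indepFun {A : Ω → α} {B : Ω → β} {C : Ω → γ} (hA : Measurable A)
    (hB : Measurable B) (hC : Measurable C) (h : IndepFun (fun ω => (A ω, B ω)) C P)
    (hAB : IndepFun A B P) : IndepFun (fun ω => (A ω, C ω)) B P := by
  have : IsProbabilityMeasure (P.map A) := Measure.isProbabilityMeasure_map hA.aemeasurable
  have : IsProbabilityMeasure (P.map B) := Measure.isProbabilityMeasure_map hB.aemeasurable
  have : IsProbabilityMeasure (P.map C) := Measure.isProbabilityMeasure_map hC.aemeasurable
  have hAC : IndepFun A C P := h.comp measurable_fst measurable_id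
  rw [indepFun_iff_map_prod_eq_prod_map_map (by fun_prop) (by fun_prop)] at h hAB hAC ⊢
  rw [hAB] at h
  rw [hAC]
  have h1 := measurePreserving_prodAssoc (P.map A) (P.map B) (P.map C)
  have h2 := (MeasurePreserving.id (P.map A)).prod
    (Measure.measurePreserving_swap (μ := P.map B) (ν := P.map C))
  have h3 := (measurePreserving_prodAssoc (P.map A) (P.map C) (P.map B)).symm
  have h4 := (h3.comp (h2.comp h1)).map_eq
  rw [← h, Measure.map_map (by fun_prop) (by fun_prop)] at h4
  rw [← h4]
  rfl

end Independence

/-! ### Conditionally centered noise. -/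

section Noise

variable {Ω 𝒳 Ξ : Type*} {mΩ : MeasurableSpace Ω} [MeasurableSpace 𝒳] [MeasurableSpace Ξ]
  {P : Measure Ω} {p : ℕ}

theorem integrable_inner_of_memLp {v w : Ω → EuclideanSpace ℝ (Fin p)} (hv : MemLp v 2 P)
    (hw : MemLp w 2 P) : Integrable (fun ω => ⟪v ω, w ω⟫_ℝ) P := by
  have h := (hv.norm.integrable_mul hw.norm)
  refine h.mono' (hv.1.inner hw.1) (Filter.Eventually.of_forall fun ω => ?_)
  exact norm_inner_le_norm _ _

/-- Oracle properties at fixed points pass to a random point independent of the sample: the joint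
law is a product, so Tonelli gives the variance bound and Fubini the vanishing correlation. It is
applied with `X = id` into `Ω` carrying a smaller `σ`-algebra, so that functions of `X` are exactly
the functions measurable for it. -/
theorem noise_of_indepFun [IsProbabilityMeasure P] {X : Ω → 𝒳} {Y : Ω → Ξ}
    (hX : Measurable X) (hY : Measurable Y)
    (hXY : IndepFun X Y P)
    {φ : EuclideanSpace ℝ (Fin p) → Ξ → EuclideanSpace ℝ (Fin p)}
    {m : EuclideanSpace ℝ (Fin p) → EuclideanSpace ℝ (Fin p)} {σ : ℝ}
    (hφ : Measurable (Function.uncurry φ)) (hm : Measurable m)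
    (hint : ∀ x, Integrable (fun ω => φ x (Y ω)) P) (hmean : ∀ x, ∫ ω, φ x (Y ω) ∂P = m x)
    (hsq : ∀ x, Integrable (fun ω => ‖φ x (Y ω) - m x‖ ^ 2) P)
    (hvar : ∀ x, ∫ ω, ‖φ x (Y ω) - m x‖ ^ 2 ∂P ≤ σ ^ 2)
    {a : 𝒳 → EuclideanSpace ℝ (Fin p)} (ha : Measurable a) :
    MemLp (fun ω => φ (a (X ω)) (Y ω) - m (a (X ω))) 2 P ∧
      ∫ ω, ‖φ (a (X ω)) (Y ω) - m (a (X ω))‖ ^ 2 ∂P ≤ σ ^ 2 ∧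
      ∀ ψ : 𝒳 → EuclideanSpace ℝ (Fin p), Measurable ψ → MemLp (fun ω => ψ (X ω)) 2 P →
        ∫ ω, ⟪ψ (X ω), φ (a (X ω)) (Y ω) - m (a (X ω))⟫_ℝ ∂P = 0 := by
  have : IsProbabilityMeasure (P.map X) := Measure.isProbabilityMeasure_map hX.aemeasurable
  have : IsProbabilityMeasure (P.map Y) := Measure.isProbabilityMeasure_map hY.aemeasurable
  have hmap := hXY.map_prod_eq_prod_map_map hX.aemeasurable hY.aemeasurable
  have hXYm : Measurable fun ω => (X ω, Y ω) := hX.prodMk hY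
  let F : 𝒳 × Ξ → EuclideanSpace ℝ (Fin p) := fun q => φ (a q.1) q.2 - m (a q.1)
  have hF : Measurable F := by
    refine Measurable.sub ?_ (hm.comp (ha.comp measurable_fst))
    exact hφ.comp ((ha.comp measurable_fst).prodMk measurable_snd)
  have hl : ∫⁻ ω, ENNReal.ofReal (‖F (X ω, Y ω)‖ ^ 2) ∂P ≤ ENNReal.ofReal (σ ^ 2) := by
    have hF2 : Measurable fun q => ENNReal.ofReal (‖F q‖ ^ 2) := by fun_prop
    rw [← lintegral_map (f := fun q => ENNReal.ofReal (‖F q‖ ^ 2)) hF2 hXYm, hmap,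
      lintegral_prod _ hF2.aemeasurable]
    calc ∫⁻ x, ∫⁻ y, ENNReal.ofReal (‖F (x, y)‖ ^ 2) ∂(P.map Y) ∂(P.map X)
        ≤ ∫⁻ _, ENNReal.ofReal (σ ^ 2) ∂(P.map X) := by
          refine lintegral_mono fun x => ?_
          have h1 : Measurable fun y => ENNReal.ofReal (‖F (x, y)‖ ^ 2) :=
            hF2.comp measurable_prodMk_left
          rw [lintegral_map h1 hY, ← ofReal_integral_eq_lintegral_ofReal (hsq (a x))
            (Filter.Eventually.of_forall fun _ => sq_nonneg _)]
          exact ENNReal.ofReal_le_ofReal (hvar (a x))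
      _ = ENNReal.ofReal (σ ^ 2) := by simp
  have hFm : Measurable fun ω => F (X ω, Y ω) := hF.comp hXYm
  have hi : Integrable (fun ω => ‖F (X ω, Y ω)‖ ^ 2) P := by
    rw [← lintegral_ofReal_ne_top_iff_integrable (hFm.norm.pow_const 2).aestronglyMeasurable
      (Filter.Eventually.of_forall fun _ => sq_nonneg _)]
    exact (hl.trans_lt ENNReal.ofReal_lt_top).ne
  have hL2 : MemLp (fun ω => F (X ω, Y ω)) 2 P :=
    (memLp_two_iff_integrable_sq_norm hFm.aestronglyMeasurable).2 hi
  refine ⟨hL2, ?_, fun ψ hψ hψ2 => ?_⟩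
  · rw [← ENNReal.ofReal_le_ofReal_iff (sq_nonneg σ), ofReal_integral_eq_lintegral_ofReal hi
      (Filter.Eventually.of_forall fun _ => sq_nonneg _)]
    exact hl
  · let H : 𝒳 × Ξ → ℝ := fun q => ⟪ψ q.1, F q⟫_ℝ
    have hH : Measurable H := (hψ.comp measurable_fst).inner hF
    have hHi : Integrable H (P.map fun ω => (X ω, Y ω)) :=
      (integrable_map_measure hH.aestronglyMeasurable hXYm.aemeasurable).2
        (integrable_inner_of_memLp hψ2 hL2)
    change ∫ ω, H (X ω, Y ω) ∂P = 0
    rw [← integral_map (f := H) hXYm.aemeasurable hH.aestronglyMeasurable]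
    rw [hmap] at hHi ⊢
    rw [integral_prod _ hHi]
    refine integral_eq_zero_of_ae (Filter.Eventually.of_forall fun x => ?_)
    have h1 : Measurable fun y => H (x, y) := hH.comp measurable_prodMk_left
    change ∫ y, H (x, y) ∂(P.map Y) = 0
    rw [integral_map hY.aemeasurable h1.aestronglyMeasurable]
    change ∫ ω, ⟪ψ x, φ (a x) (Y ω) - m (a x)⟫_ℝ ∂P = 0
    refine (integral_inner (𝕜 := ℝ) (f := fun ω => φ (a x) (Y ω) - m (a x))
      ((hint (a x)).sub (integrable_const _)) (ψ x)).trans ?_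
    rw [integral_sub (hint (a x)) (integrable_const _), hmean]
    simp

/-- `w` is a square integrable noise, centered given the `σ`-algebra `m`, uncorrelated between
agents. -/
structure IsNoise {n : ℕ} (P : Measure Ω) (m : MeasurableSpace Ω) (σ : ℝ)
    (w : Fin n → Ω → EuclideanSpace ℝ (Fin p)) : Prop where
  memLp : ∀ i, MemLp (w i) 2 P
  integral_sq_le : ∀ i, ∫ ω, ‖w i ω‖ ^ 2 ∂P ≤ σ ^ 2
  inner_past : ∀ i (ψ : Ω → EuclideanSpace ℝ (Fin p)), Measurable[m] ψ → MemLp ψ 2 P →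
    ∫ ω, ⟪ψ ω, w i ω⟫_ℝ ∂P = 0
  inner_ne : ∀ i j, i ≠ j → ∫ ω, ⟪w i ω, w j ω⟫_ℝ ∂P = 0

theorem memLp_avg {n : ℕ} {w : Fin n → Ω → EuclideanSpace ℝ (Fin p)}
    (h : ∀ i, MemLp (w i) 2 P) : MemLp (fun ω => avg fun i => w i ω) 2 P := by
  exact (memLp_finsetSum _ fun i _ => h i).const_smul (n : ℝ)⁻¹

theorem integrable_norm_sq {w : Ω → EuclideanSpace ℝ (Fin p)} (h : MemLp w 2 P) :
    Integrable (fun ω => ‖w ω‖ ^ 2) P :=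
  (memLp_two_iff_integrable_sq_norm h.1).1 h

variable {n : ℕ} {m : MeasurableSpace Ω} {σ : ℝ} {w : Fin n → Ω → EuclideanSpace ℝ (Fin p)}

theorem IsNoise.integral_sum_sq_le (h : IsNoise P m σ w) :
    ∫ ω, ∑ i, ‖w i ω‖ ^ 2 ∂P ≤ n * σ ^ 2 := by
  rw [integral_finsetSum _ fun i _ => integrable_norm_sq (h.memLp i)]
  exact (Finset.sum_le_sum fun i _ => h.integral_sq_le i).trans (by simp)

theorem IsNoise.integral_sum_inner (h : IsNoise P m σ w)
    {ψ : Fin n → Ω → EuclideanSpace ℝ (Fin p)} (hψ : ∀ i, Measurable[m] (ψ i))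
    (hψ2 : ∀ i, MemLp (ψ i) 2 P) : ∫ ω, ∑ i, ⟪ψ i ω, w i ω⟫_ℝ ∂P = 0 := by
  rw [integral_finsetSum _ fun i _ => integrable_inner_of_memLp (hψ2 i) (h.memLp i)]
  exact Finset.sum_eq_zero fun i _ => h.inner_past i _ (hψ i) (hψ2 i)

theorem IsNoise.integral_inner_avg (h : IsNoise P m σ w)
    {ψ : Ω → EuclideanSpace ℝ (Fin p)} (hψ : Measurable[m] ψ) (hψ2 : MemLp ψ 2 P) :
    ∫ ω, ⟪ψ ω, avg fun i => w i ω⟫_ℝ ∂P = 0 := by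
  simp_rw [avg, real_inner_smul_right, inner_sum]
  rw [integral_const_mul, h.integral_sum_inner (fun _ => hψ) (fun _ => hψ2), mul_zero]

/-- Off-diagonal correlations vanish, so averaging divides the variance by `n`. This is the source
of the linear speedup in the centralized rate. -/
theorem IsNoise.integral_avg_sq_le (h : IsNoise P m σ w) (hn : n ≠ 0) :
    ∫ ω, ‖avg fun i => w i ω‖ ^ 2 ∂P ≤ σ ^ 2 / n := by
  have hn' : (0 : ℝ) < n := by positivity
  have h1 : ∀ ω, ‖avg fun i => w i ω‖ ^ 2
      = ((n : ℝ)⁻¹) ^ 2 * ∑ i, ∑ j, ⟪w i ω, w j ω⟫_ℝ := by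
    intro ω
    rw [avg, norm_smul, mul_pow, Real.norm_eq_abs, sq_abs, ← real_inner_self_eq_norm_sq, sum_inner]
    simp_rw [inner_sum]
  have hi := fun i j => integrable_inner_of_memLp (h.memLp i) (h.memLp j)
  simp_rw [h1]
  rw [integral_const_mul, integral_finsetSum _ fun i _ => integrable_finsetSum _ fun j _ => hi i j]
  have h2 : ∀ i, ∫ ω, ∑ j, ⟪w i ω, w j ω⟫_ℝ ∂P ≤ σ ^ 2 := by
    intro i
    rw [integral_finsetSum _ fun j _ => hi i j,
      Finset.sum_eq_single i (fun j _ hj => h.inner_ne i j hj.symm)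
        (fun h => absurd (Finset.mem_univ _) h)]
    simp_rw [real_inner_self_eq_norm_sq]
    exact h.integral_sq_le i
  calc ((n : ℝ)⁻¹) ^ 2 * ∑ i, ∫ ω, ∑ j, ⟪w i ω, w j ω⟫_ℝ ∂P
      ≤ ((n : ℝ)⁻¹) ^ 2 * ∑ _i : Fin n, σ ^ 2 := by
        gcongr with i
        exact h2 i
    _ = σ ^ 2 / n := by
        simp only [Finset.sum_const, Finset.card_univ, Fintype.card_fin, nsmul_eq_mul]
        field_simp

end Noise

/-! ### The filtration of the samples. -/

section Past

variable {Ω Ξ Z : Type*} [mΞ : MeasurableSpace Ξ] {n p : ℕ}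

/-- The `σ`-algebra generated by the samples with index in `S`. -/
abbrev past (ξ : Fin n → ℕ → Ω → Ξ) (S : Set (Fin n × ℕ)) : MeasurableSpace Ω :=
  ⨆ a ∈ S, mΞ.comap (ξ a.1 a.2)

variable {ξ : Fin n → ℕ → Ω → Ξ} {S T : Set (Fin n × ℕ)}

theorem past_mono (h : S ⊆ T) : past ξ S ≤ past ξ T :=
  biSup_mono h

theorem measurable_past {i : Fin n} {k : ℕ} (h : (i, k) ∈ S) : Measurable[past ξ S] (ξ i k) := by
  refine measurable_iff_comap_le.2 ?_
  exact le_biSup (fun a : Fin n × ℕ => mΞ.comap (ξ a.1 a.2)) h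

variable [mΩ : MeasurableSpace Ω] [mZ : MeasurableSpace Z] {P : Measure Ω}
  {ζ : Fin n → ℕ → Ω → Z}

theorem IsIndependentNoise.past_le (h : IsIndependentNoise P ξ ζ) (S : Set (Fin n × ℕ)) :
    past ξ S ≤ mΩ :=
  iSup₂_le fun a _ => (h.measurable_grad a.1 a.2).comap_le

theorem IsIndependentNoise.indep_past (h : IsIndependentNoise P ξ ζ) {i : Fin n} {k : ℕ}
    (hk : (i, k) ∉ S) :
    @IndepFun Ω Ω (Ξ × Z) mΩ (past ξ S) _ id (fun ω => (ξ i k ω, ζ i k ω)) P := by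
  rw [@IndepFun_iff_Indep Ω Ω (Ξ × Z) mΩ (past ξ S), MeasurableSpace.comap_id]
  have h1 := (iIndepFun_iff_iIndep _ _ _).1 h.indep_pairs
  have h2 := indep_iSup_of_disjoint (S := S) (T := {(i, k)})
    (fun a => ((h.measurable_grad a.1 a.2).prodMk (h.measurable_comp a.1 a.2)).comap_le) h1
    (by simpa using hk)
  refine indep_of_indep_of_le h2 (iSup₂_mono fun a _ => ?_) (by simp)
  exact ((Measurable.comap_le (m₁ := MeasurableSpace.comap
    (fun ω => (ξ a.1 a.2 ω, ζ a.1 a.2 ω)) inferInstance))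
      (measurable_fst.comp (comap_measurable _)))

theorem IsIndependentNoise.indep_past_grad (h : IsIndependentNoise P ξ ζ) {i : Fin n} {k : ℕ}
    (hk : (i, k) ∉ S) :
    @IndepFun Ω Ω Ξ mΩ (past ξ S) _ id (ξ i k) P :=
  @IndepFun.comp Ω Ω (Ξ × Z) Ω Ξ mΩ P id (fun ω => (ξ i k ω, ζ i k ω)) (past ξ S) _ (past ξ S) _
    id Prod.fst (h.indep_past hk) (@measurable_id _ (past ξ S)) measurable_fst

/-- Independence is assumed for the pairs `(ξ i k, ζ i k)`. The gradient sample sharing a pair with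
`ζ i k` has to be moved to the side of the other gradient samples, which is what
`indepFun_prodMk_of_indepFun` does. -/
theorem IsIndependentNoise.indep_past_comp [IsProbabilityMeasure P]
    (h : IsIndependentNoise P ξ ζ) (i : Fin n) (k : ℕ) :
    @IndepFun Ω Ω Z mΩ (past ξ Set.univ) _ id (ζ i k) P := by
  let S : Set (Fin n × ℕ) := {(i, k)}ᶜ
  have h0 := h.indep_past (i := i) (k := k) (S := S) (by simp [S])
  have h1 : @IndepFun Ω (Ξ × Z) Ω mΩ _ (past ξ S) (fun ω => (ξ i k ω, ζ i k ω)) id P := by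
    rw [@IndepFun_iff_Indep] at h0 ⊢
    exact h0.symm
  have h2 := @indepFun_prodMk_of_indepFun Ω Ξ Z Ω mΩ _ _ (past ξ S) P _ (ξ i k) (ζ i k) id
    (h.measurable_grad i k) (h.measurable_comp i k) (h.past_le S) h1 (h.indep_grad_comp i k)
  rw [@IndepFun_iff_Indep Ω _ Z mΩ] at h2 ⊢
  refine indep_of_indep_of_le_left h2 ?_
  rw [MeasurableSpace.comap_id]
  refine iSup₂_le fun a _ => ?_
  by_cases ha : a = (i, k)
  · subst ha
    exact Measurable.comap_le (measurable_fst.comp (comap_measurable _))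
  · have h3 : mΞ.comap (ξ a.1 a.2) ≤ past ξ S :=
      (measurable_past (S := S) (i := a.1) (k := a.2) ha).comap_le
    refine h3.trans ?_
    have h4 : past ξ S = (past ξ S).comap id := MeasurableSpace.comap_id.symm
    conv_lhs => rw [h4]
    exact Measurable.comap_le
      ((@measurable_snd _ _ _ (past ξ S)).comp (@comap_measurable _ _ _ _))

variable {σ L : ℝ} {f : Fin n → EuclideanSpace ℝ (Fin p) → ℝ} {fInf : Fin n → ℝ}
  {g : Fin n → EuclideanSpace ℝ (Fin p) → Ξ → EuclideanSpace ℝ (Fin p)}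

theorem IsSmoothBelow.continuous_gradient (h : IsSmoothBelow L f fInf) (i : Fin n) :
    Continuous (gradient (f i)) := by
  have h1 : LipschitzWith L.toNNReal (gradient (f i)) := by
    refine LipschitzWith.of_dist_le_mul fun x y => ?_
    rw [dist_eq_norm, dist_eq_norm]
    exact (h.lipschitz i x y).trans
      (mul_le_mul_of_nonneg_right (Real.le_coe_toNNReal L) (norm_nonneg _))
  exact h1.continuous

theorem IsGradientOracle.isNoise [IsProbabilityMeasure P] (ho : IsGradientOracle P σ f g ξ)
    (hs : IsSmoothBelow L f fInf) (hi : IsIndependentNoise P ξ ζ)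
    {x : Fin n → Ω → EuclideanSpace ℝ (Fin p)} (hx : ∀ i, Measurable[past ξ S] (x i)) {k : ℕ}
    (hk : ∀ i, (i, k) ∉ S) :
    IsNoise P (past ξ S) σ
      (fun i ω => g i (x i ω) (ξ i k ω) - gradient (f i) (x i ω)) := by
  -- The choice `T = S` serves the single-agent properties. For the correlation of agents `i` and
  -- `j`, the sample `(i, k)` is added to the past, so that the noise of `i` becomes an admissible
  -- test vector for `j`.
  have key : ∀ (T : Set (Fin n × ℕ)) (i : Fin n), S ⊆ T → (i, k) ∉ T → _ :=
    fun T i hST hiT =>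
      @noise_of_indepFun Ω Ω Ξ mΩ (past ξ T) _ P p _ id (ξ i k) (hi.past_le T)
        (hi.measurable_grad i k) (hi.indep_past_grad hiT) (g i) (gradient (f i)) σ
        (ho.measurable i) (hs.continuous_gradient i).measurable (ho.integrable i k)
        (ho.unbiased i k) (ho.integrable_sq i k) (ho.variance_le i k) (x i)
        ((hx i).mono (past_mono hST) le_rfl)
  refine ⟨fun i => (key S i subset_rfl (hk i)).1, fun i => (key S i subset_rfl (hk i)).2.1,
    fun i => (key S i subset_rfl (hk i)).2.2, fun i j hij => ?_⟩
  have h1 := (key (insert (i, k) S) j (Set.subset_insert _ _)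
    (by simp [hk, hij.symm])).2.2
  refine h1 (fun ω => g i (x i ω) (ξ i k ω) - gradient (f i) (x i ω)) ?_
    (key S i subset_rfl (hk i)).1
  have hxi : Measurable[past ξ (insert (i, k) S)] (x i) :=
    (hx i).mono (past_mono (Set.subset_insert _ _)) le_rfl
  have hξ : Measurable[past ξ (insert (i, k) S)] (ξ i k) := measurable_past (Set.mem_insert _ _)
  exact ((ho.measurable i).comp (hxi.prodMk hξ)).sub
    ((hs.continuous_gradient i).measurable.comp hxi)

variable {𝒞 : EuclideanSpace ℝ (Fin p) → Z → EuclideanSpace ℝ (Fin p)}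

/-- A compressor with parameter `0` is almost surely the identity at points that do not depend on
the compression sample. -/
theorem IsUnbiasedCompressor.ae_eq [IsProbabilityMeasure P] (hc : IsUnbiasedCompressor P 0 𝒞 ζ)
    (hi : IsIndependentNoise P ξ ζ) {v : Ω → EuclideanSpace ℝ (Fin p)}
    (hv : Measurable[past ξ Set.univ] v) (i : Fin n) (k : ℕ) :
    ∀ᵐ ω ∂P, 𝒞 (v ω) (ζ i k ω) = v ω := by
  have h := @noise_of_indepFun Ω Ω Z mΩ (past ξ Set.univ) _ P p _ id (ζ i k) (hi.past_le _)
    (hi.measurable_comp i k) (hi.indep_past_comp i k) 𝒞 id 0 hc.measurable measurable_id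
    (hc.integrable i k) (hc.unbiased i k) (hc.integrable_sq i k)
    (fun x => (hc.variance_le i k x).trans (by simp)) v hv
  have h1 := integrable_norm_sq h.1
  have h2 := (integral_eq_zero_iff_of_nonneg (fun _ => sq_nonneg _) h1).1
    (le_antisymm (h.2.1.trans (by simp)) (integral_nonneg fun _ => sq_nonneg _))
  filter_upwards [h2] with ω hω
  simpa [sub_eq_zero] using hω

end Past

end CEDAS

namespace CEDAS

open scoped InnerProductSpace

/-! ### Expected descent and expected contraction of the energy. -/

section Measurability

variable {Ω : Type*} [MeasurableSpace Ω] {n p : ℕ}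
  {gr : Fin n → EuclideanSpace ℝ (Fin p) → EuclideanSpace ℝ (Fin p)}

theorem measurable_avg {x : Ω → Fin n → EuclideanSpace ℝ (Fin p)}
    (hx : ∀ i, Measurable fun ω => x ω i) : Measurable fun ω => avg (x ω) := by
  unfold avg
  fun_prop

theorem measurable_projStep (hgr : ∀ i, Continuous (gr i))
    {x : Ω → Fin n → EuclideanSpace ℝ (Fin p)} (hx : ∀ i, Measurable fun ω => x ω i)
    (u : Fin n → Fin n → ℝ) (a₀ : Fin n) (η : ℝ) (i : Fin n) :
    Measurable fun ω => projStep u a₀ gr η (x ω) i := by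
  have h1 := fun i => (hgr i).measurable.comp (hx i)
  have h2 := fun i => (hgr i).measurable.comp (measurable_avg hx)
  have h3 := measurable_avg hx
  simp only [Function.comp_def] at h1 h2
  unfold projStep coef meanStep
  fun_prop

theorem measurable_gradient_sub (hgr : ∀ i, Continuous (gr i))
    {F : EuclideanSpace ℝ (Fin p) → EuclideanSpace ℝ (Fin p)} (hF : Continuous F)
    {x : Ω → Fin n → EuclideanSpace ℝ (Fin p)} (hx : ∀ i, Measurable fun ω => x ω i) (c : ℝ) :
    Measurable fun ω => F (avg (x ω)) - c • avg fun i => gr i (x ω i) :=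
  (hF.measurable.comp (measurable_avg hx)).sub
    ((measurable_avg fun i => (hgr i).measurable.comp (hx i)).const_smul c)

end Measurability

section Moments

variable {Ω : Type*} {mΩ : MeasurableSpace Ω} {P : Measure Ω} {n p : ℕ}

theorem memLp_of_lipschitz [IsFiniteMeasure P] {L : ℝ}
    {F : EuclideanSpace ℝ (Fin p) → EuclideanSpace ℝ (Fin p)}
    (hF : ∀ x y, ‖F x - F y‖ ≤ L * ‖x - y‖) (hc : Continuous F)
    {v : Ω → EuclideanSpace ℝ (Fin p)} (hv : MemLp v 2 P) : MemLp (fun ω => F (v ω)) 2 P := by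
  have h1 : MemLp (fun ω => F (v ω) - F 0) 2 P := by
    refine hv.of_le_mul (c := L) ((hc.comp_aestronglyMeasurable hv.1).sub
      aestronglyMeasurable_const) (Filter.Eventually.of_forall fun ω => ?_)
    simpa using hF (v ω) 0
  convert h1.add (memLp_const (F 0)) using 1
  funext ω
  simp

theorem memLp_coef (u : Fin n → Fin n → ℝ) (a : Fin n) {x : Ω → Fin n → EuclideanSpace ℝ (Fin p)}
    (hx : ∀ i, MemLp (fun ω => x ω i) 2 P) : MemLp (fun ω => coef u a (x ω)) 2 P :=
  memLp_finsetSum _ fun i _ => (hx i).const_smul (u a i)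

theorem integrable_sum_norm_sq {x : Ω → Fin n → EuclideanSpace ℝ (Fin p)}
    (hx : ∀ i, MemLp (fun ω => x ω i) 2 P) : Integrable (fun ω => ∑ i, ‖x ω i‖ ^ 2) P :=
  integrable_finsetSum _ fun i _ => integrable_norm_sq (hx i)

theorem integrable_energy (u : Fin n → Fin n → ℝ) (μ : Fin n → ℝ) (a₀ : Fin n)
    {x z : Ω → Fin n → EuclideanSpace ℝ (Fin p)}
    (hx : ∀ i, MemLp (fun ω => x ω i) 2 P) (hz : ∀ i, MemLp (fun ω => z ω i) 2 P) :
    Integrable (fun ω => energy u μ a₀ (x ω) (z ω)) P :=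
  integrable_finsetSum _ fun a _ => (integrable_norm_sq (memLp_coef u a hx)).add
    ((integrable_norm_sq (memLp_coef u a hz)).const_mul _)

theorem memLp_sub_avg {x : Ω → Fin n → EuclideanSpace ℝ (Fin p)}
    (hx2 : ∀ i, MemLp (fun ω => x ω i) 2 P) (i : Fin n) :
    MemLp (fun ω => x ω i - avg (x ω)) 2 P :=
  (hx2 i).sub (memLp_avg hx2)

variable [IsProbabilityMeasure P] {m : MeasurableSpace Ω} {σ L η : ℝ}
  {f : Fin n → EuclideanSpace ℝ (Fin p) → ℝ} {fInf : Fin n → ℝ}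
  {x w : Ω → Fin n → EuclideanSpace ℝ (Fin p)}

theorem IsSmoothBelow.memLp_gradient (h : IsSmoothBelow L f fInf) (i : Fin n)
    {v : Ω → EuclideanSpace ℝ (Fin p)} (hv : MemLp v 2 P) :
    MemLp (fun ω => gradient (f i) (v ω)) 2 P :=
  memLp_of_lipschitz (h.lipschitz i) (h.continuous_gradient i) hv

theorem IsSmoothBelow.continuous_gradient_objective (h : IsSmoothBelow L f fInf) :
    Continuous (gradient (objective f)) := by
  rw [funext h.gradient_objective]
  unfold avg
  have := h.continuous_gradient
  fun_prop

theorem IsSmoothBelow.memLp_gradient_objective (h : IsSmoothBelow L f fInf)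
    {v : Ω → EuclideanSpace ℝ (Fin p)} (hv : MemLp v 2 P) :
    MemLp (fun ω => gradient (objective f) (v ω)) 2 P := by
  simp_rw [h.gradient_objective]
  exact memLp_avg fun i => h.memLp_gradient i hv

/-- The mean squared increment of the average iterate. -/
theorem IsNoise.integral_sq_avg_add_le (hw : IsNoise P m σ fun i ω => w ω i) (hn : n ≠ 0)
    (h : IsSmoothBelow L f fInf) (hx : ∀ i, Measurable[m] fun ω => x ω i)
    (hx2 : ∀ i, MemLp (fun ω => x ω i) 2 P) :
    ∫ ω, ‖avg fun i => gradient (f i) (x ω i) + w ω i‖ ^ 2 ∂P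
      ≤ ∫ ω, ‖avg fun i => gradient (f i) (x ω i)‖ ^ 2 ∂P + σ ^ 2 / n := by
  have hM : MemLp (fun ω => avg fun i => gradient (f i) (x ω i)) 2 P :=
    memLp_avg fun i => h.memLp_gradient i (hx2 i)
  have hA : MemLp (fun ω => avg fun i => w ω i) 2 P := memLp_avg hw.memLp
  have hMm : Measurable[m] fun ω => avg fun i => gradient (f i) (x ω i) :=
    @measurable_avg Ω m n p (fun ω i => gradient (f i) (x ω i))
      fun i => (h.continuous_gradient i).measurable.comp (hx i)
  have h0 := hw.integral_inner_avg hMm hM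
  have h1 : ∀ ω, ‖avg fun i => gradient (f i) (x ω i) + w ω i‖ ^ 2
      = ‖avg fun i => gradient (f i) (x ω i)‖ ^ 2
        + 2 * ⟪avg fun i => gradient (f i) (x ω i), avg fun i => w ω i⟫_ℝ
        + ‖avg fun i => w ω i‖ ^ 2 := by
    intro ω
    rw [← norm_add_sq_real]
    simp [avg, Finset.sum_add_distrib]
  simp_rw [h1]
  have hi := integrable_inner_of_memLp hM hA
  rw [integral_add (by exact (integrable_norm_sq hM).add (hi.const_mul 2)) (integrable_norm_sq hA),
    integral_add (integrable_norm_sq hM) (hi.const_mul 2), integral_const_mul, h0]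
  linarith [hw.integral_avg_sq_le hn]

/-- The bound of the increment of the objective in `IsSmoothBelow.descent`. -/
noncomputable def descentBound (f : Fin n → EuclideanSpace ℝ (Fin p) → ℝ) (L η : ℝ)
    (x w : Fin n → EuclideanSpace ℝ (Fin p)) : ℝ :=
  η * L ^ 2 / (2 * n) * ∑ i, ‖x i - avg x‖ ^ 2 + L / 2 * η ^ 2 * ‖avg w‖ ^ 2
    - η / 2 * ‖gradient (objective f) (avg x)‖ ^ 2
    - η / 2 * (1 - η * L) * ‖avg fun i => gradient (f i) (x i)‖ ^ 2
    - η * ⟪gradient (objective f) (avg x) - (η * L) • (avg fun i => gradient (f i) (x i)),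
        avg w⟫_ℝ

theorem IsNoise.integral_descentBound_le (hw : IsNoise P m σ fun i ω => w ω i) (hn : n ≠ 0)
    (hL : 0 < L) (h : IsSmoothBelow L f fInf) (hx : ∀ i, Measurable[m] fun ω => x ω i)
    (hx2 : ∀ i, MemLp (fun ω => x ω i) 2 P) :
    Integrable (fun ω => descentBound f L η (x ω) (w ω)) P ∧
    ∫ ω, descentBound f L η (x ω) (w ω) ∂P
      ≤ η * L ^ 2 / (2 * n) * ∫ ω, ∑ i, ‖x ω i - avg (x ω)‖ ^ 2 ∂P
        + L / 2 * η ^ 2 * (σ ^ 2 / n)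
        - η / 2 * ∫ ω, ‖gradient (objective f) (avg (x ω))‖ ^ 2 ∂P
        - η / 2 * (1 - η * L) * ∫ ω, ‖avg fun i => gradient (f i) (x ω i)‖ ^ 2 ∂P := by
  have hM : MemLp (fun ω => avg fun i => gradient (f i) (x ω i)) 2 P :=
    memLp_avg fun i => h.memLp_gradient i (hx2 i)
  have hA : MemLp (fun ω => avg (w ω)) 2 P := memLp_avg hw.memLp
  have hΓ : MemLp (fun ω => gradient (objective f) (avg (x ω))) 2 P :=
    h.memLp_gradient_objective (memLp_avg hx2)
  have hψ : MemLp (fun ω => gradient (objective f) (avg (x ω))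
      - (η * L) • (avg fun i => gradient (f i) (x ω i))) 2 P := hΓ.sub (hM.const_smul (η * L))
  have h0 := hw.integral_inner_avg (@measurable_gradient_sub Ω m n p (fun i => gradient (f i))
    h.continuous_gradient _ h.continuous_gradient_objective x hx (η * L)) hψ
  have i1 : Integrable (fun ω => η * L ^ 2 / (2 * n) * ∑ i, ‖x ω i - avg (x ω)‖ ^ 2) P :=
    (integrable_sum_norm_sq (memLp_sub_avg hx2)).const_mul _
  have i2 : Integrable (fun ω => L / 2 * η ^ 2 * ‖avg (w ω)‖ ^ 2) P :=
    (integrable_norm_sq hA).const_mul _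
  have i3 : Integrable (fun ω => η / 2 * ‖gradient (objective f) (avg (x ω))‖ ^ 2) P :=
    (integrable_norm_sq hΓ).const_mul _
  have i4 : Integrable (fun ω => η / 2 * (1 - η * L) *
      ‖avg fun i => gradient (f i) (x ω i)‖ ^ 2) P := (integrable_norm_sq hM).const_mul _
  have i5 : Integrable (fun ω => η * ⟪gradient (objective f) (avg (x ω))
      - (η * L) • (avg fun i => gradient (f i) (x ω i)), avg (w ω)⟫_ℝ) P :=
    (integrable_inner_of_memLp hψ hA).const_mul _
  refine ⟨(((i1.add i2).sub i3).sub i4).sub i5, ?_⟩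
  unfold descentBound
  rw [integral_sub (by exact ((i1.add i2).sub i3).sub i4) i5,
    integral_sub (by exact (i1.add i2).sub i3) i4, integral_sub (by exact i1.add i2) i3,
    integral_add i1 i2]
  simp only [integral_const_mul]
  rw [h0, mul_zero, sub_zero]
  have := mul_le_mul_of_nonneg_left (hw.integral_avg_sq_le hn)
    (show 0 ≤ L / 2 * η ^ 2 by positivity)
  linarith

variable {W : Matrix (Fin n) (Fin n) ℝ} {ν : ℝ} {u : Fin n → Fin n → ℝ} {μ : Fin n → ℝ}
  {a₀ : Fin n}

/-- The expected energy contracts in one step up to noise and drift. -/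
theorem IsNoise.integral_energy_step (hw : IsNoise P m σ fun i ω => w ω i) (hn : n ≠ 0)
    (h : IsSmoothBelow L f fInf) (hx : ∀ i, Measurable[m] fun ω => x ω i)
    (hx2 : ∀ i, MemLp (fun ω => x ω i) 2 P)
    (hu : IsModeSystem W ν u μ a₀) (hs : ∀ i j, W i j = W j i) (hcol : ∀ j, ∑ i, W i j = 1)
    (hβ : 0 < 1 - ν) (hν : -1 ≤ ν)
    (hL : 0 < L) (hη : 0 < η) (hτ : 512 * (η * L) ^ 2 ≤ (1 - ν) ^ 2)
    {d y x' d' : Ω → Fin n → EuclideanSpace ℝ (Fin p)}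
    (hd2 : ∀ i, MemLp (fun ω => d ω i) 2 P)
    (hx2' : ∀ i, MemLp (fun ω => x' ω i) 2 P) (hd2' : ∀ i, MemLp (fun ω => d' ω i) 2 P)
    (hd : ∀ ω, ∑ i, d ω i = 0)
    (hy : ∀ ω i, y ω i = x ω i - η • (gradient (f i) (x ω i) + w ω i) - d ω i)
    (hx' : ∀ ω i, x' ω i = y ω i - (1 / 4 : ℝ) • (y ω i - ∑ j, W i j • y ω j))
    (hd' : ∀ ω i, d' ω i = d ω i + (1 / 4 : ℝ) • (y ω i - ∑ j, W i j • y ω j)) :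
    ∫ ω, energy u μ a₀ (x' ω) (fun i => d' ω i + η • gradient (f i) (avg (x' ω))) ∂P
      ≤ (1 - (1 - ν) / 16) *
          ∫ ω, energy u μ a₀ (x ω) (fun i => d ω i + η • gradient (f i) (avg (x ω))) ∂P
        + η ^ 2 * (n * σ ^ 2)
        + 72 / (1 - ν) ^ 2 * (n * L ^ 2 * η ^ 4 *
          (∫ ω, ‖avg fun i => gradient (f i) (x ω i)‖ ^ 2 ∂P + σ ^ 2 / n)) := by
  set ψ : Ω → Fin n → EuclideanSpace ℝ (Fin p) :=
    fun ω => projStep u a₀ (fun i => gradient (f i)) η (x ω) with hψdef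
  have hψm : ∀ i, Measurable[m] fun ω => ψ ω i := fun i =>
    @measurable_projStep Ω m n p (fun i => gradient (f i)) h.continuous_gradient x hx u a₀ η i
  have hψ2 : ∀ i, MemLp (fun ω => ψ ω i) 2 P := by
    intro i
    refine memLp_finsetSum _ fun a _ => (memLp_coef u a fun i => ?_).const_smul (u a i)
    exact (hx2 i).sub (((h.memLp_gradient i (hx2 i)).sub
      (h.memLp_gradient i (memLp_avg hx2))).const_smul η)
  have hstep : ∀ ω, (∑ i, d' ω i = 0) ∧ avg (x' ω)
      = avg (x ω) - η • avg (fun i => gradient (f i) (x ω i) + w ω i) := fun ω =>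
    sum_avg_of_step hcol (hd ω) (hy ω) (hx' ω) (hd' ω)
  have hG2 : MemLp (fun ω => avg fun i => gradient (f i) (x ω i) + w ω i) 2 P :=
    memLp_avg fun i => (h.memLp_gradient i (hx2 i)).add (hw.memLp i)
  -- The target `η ∇f i(x̄)` moves only because the average does, by `η` times the averaged noisy
  -- gradient; hence the factor `η⁴` once the drift is multiplied by `η²`.
  have hdrift : ∀ ω, ∑ i, ‖gradient (f i) (avg (x' ω)) - gradient (f i) (avg (x ω))‖ ^ 2
      ≤ n * L ^ 2 * η ^ 2 * ‖avg fun i => gradient (f i) (x ω i) + w ω i‖ ^ 2 := by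
    intro ω
    have h1 : ‖avg (x' ω) - avg (x ω)‖ ^ 2
        = η ^ 2 * ‖avg fun i => gradient (f i) (x ω i) + w ω i‖ ^ 2 := by
      rw [(hstep ω).2, sub_sub_cancel_left, norm_neg, norm_smul, mul_pow, Real.norm_eq_abs, sq_abs]
    calc _ ≤ ∑ _i : Fin n, L ^ 2 * ‖avg (x' ω) - avg (x ω)‖ ^ 2 := by
          refine Finset.sum_le_sum fun i _ => ?_
          rw [← mul_pow]
          exact pow_le_pow_left₀ (norm_nonneg _) (h.lipschitz i _ _) 2
      _ = _ := by
          rw [h1]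
          simp only [Finset.sum_const, Finset.card_univ, Fintype.card_fin, nsmul_eq_mul]
          ring
  set θ := (1 + (1 - ν) / 16) * (1 - (1 - ν) / 4) with hθdef
  have hθ0 : 0 ≤ θ := mul_nonneg (by linarith) (by linarith)
  have hθ1 : θ ≤ 1 := by rw [hθdef]; nlinarith
  have hpath : ∀ ω,
      energy u μ a₀ (x' ω) (fun i => d' ω i + η • gradient (f i) (avg (x' ω)))
      ≤ (1 - (1 - ν) / 16) *
          energy u μ a₀ (x ω) (fun i => d ω i + η • gradient (f i) (avg (x ω)))
        + (θ * η ^ 2 * ∑ i, ‖w ω i‖ ^ 2 - θ * (2 * η) * ∑ i, ⟪ψ ω i, w ω i⟫_ℝ)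
        + 72 / (1 - ν) ^ 2 * (n * L ^ 2 * η ^ 4) *
          ‖avg fun i => gradient (f i) (x ω i) + w ω i‖ ^ 2 := by
    intro ω
    have h1 := hu.energy_step hn hs hβ hν hL hη h.lipschitz hτ (hy ω) (hx' ω) (hd' ω)
      (avg (x' ω))
    have h2 := mul_le_mul_of_nonneg_left (hdrift ω)
      (show 0 ≤ 72 / (1 - ν) ^ 2 * η ^ 2 by positivity)
    change _ ≤ _ + θ * (_ - 2 * η * ∑ i, ⟪ψ ω i, w ω i⟫_ℝ) + _ at h1
    linarith
  have hz : ∀ {x d : Ω → Fin n → EuclideanSpace ℝ (Fin p)}, (∀ i, MemLp (fun ω => x ω i) 2 P) →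
      (∀ i, MemLp (fun ω => d ω i) 2 P) →
      Integrable (fun ω => energy u μ a₀ (x ω)
        (fun i => d ω i + η • gradient (f i) (avg (x ω)))) P := fun hx2 hd2 =>
    integrable_energy u μ a₀ hx2 fun i =>
      (hd2 i).add ((h.memLp_gradient i (memLp_avg hx2)).const_smul η)
  have i1 := (hz hx2 hd2).const_mul (1 - (1 - ν) / 16)
  have i2 : Integrable (fun ω => θ * η ^ 2 * ∑ i, ‖w ω i‖ ^ 2) P :=
    (integrable_sum_norm_sq hw.memLp).const_mul _
  have i3 : Integrable (fun ω => θ * (2 * η) * ∑ i, ⟪ψ ω i, w ω i⟫_ℝ) P :=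
    (integrable_finsetSum _ fun i _ =>
      integrable_inner_of_memLp (hψ2 i) (hw.memLp i)).const_mul _
  have i4 := (integrable_norm_sq hG2).const_mul (72 / (1 - ν) ^ 2 * (n * L ^ 2 * η ^ 4))
  have hint := integral_mono (hz hx2' hd2') ((i1.add (i2.sub i3)).add i4) hpath
  simp only [Pi.add_apply, Pi.sub_apply] at hint
  rw [integral_add (by exact i1.add (i2.sub i3)) i4, integral_add i1 (by exact i2.sub i3),
    integral_sub i2 i3] at hint
  simp only [integral_const_mul] at hint
  rw [hw.integral_sum_inner hψm hψ2] at hint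
  have b1 : θ * η ^ 2 * ∫ ω, ∑ i, ‖w ω i‖ ^ 2 ∂P ≤ η ^ 2 * (n * σ ^ 2) := by
    have h1 := mul_le_mul_of_nonneg_left hw.integral_sum_sq_le (show 0 ≤ θ * η ^ 2 by positivity)
    have h2 := mul_le_mul_of_nonneg_right hθ1 (show 0 ≤ η ^ 2 * (n * σ ^ 2) by positivity)
    linarith
  have b2 := mul_le_mul_of_nonneg_left (hw.integral_sq_avg_add_le hn h hx hx2)
    (show 0 ≤ 72 / (1 - ν) ^ 2 * (n * L ^ 2 * η ^ 4) by positivity)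
  linarith

end Moments

end CEDAS

/-! ### Convergence bound for an exact run. -/

namespace CEDAS

open scoped InnerProductSpace

theorem sum_le_of_contraction {V M : ℕ → ℝ} {c a b : ℝ} (hV : ∀ t, 0 ≤ V t)
    (h : ∀ t, V (t + 1) ≤ (1 - c) * V t + a + b * M t) (K : ℕ) :
    c * ∑ t ∈ Finset.range K, V t ≤ V 0 + K * a + b * ∑ t ∈ Finset.range K, M t := by
  suffices h' : c * ∑ t ∈ Finset.range K, V t + V K
      ≤ V 0 + K * a + b * ∑ t ∈ Finset.range K, M t by linarith [hV K]
  induction K with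
  | zero => simp
  | succ k ih =>
    rw [Finset.sum_range_succ, Finset.sum_range_succ]
    push_cast
    linarith [h k]

section Run

variable {Ω : Type*} {mΩ : MeasurableSpace Ω} {P : Measure Ω} {n p : ℕ}

/-- A run of the uncompressed algorithm with constant stepsize: `y` are the intermediate
variables, `w` the gradient noises, `m t` the information before the noise `w t`, and `w₀` the noise
of the initialization. -/
structure IsRun (P : Measure Ω) (W : Matrix (Fin n) (Fin n) ℝ)
    (f : Fin n → EuclideanSpace ℝ (Fin p) → ℝ) (η σ : ℝ)
    (xinit : Fin n → EuclideanSpace ℝ (Fin p)) (m₀ : MeasurableSpace Ω)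
    (m : ℕ → MeasurableSpace Ω) (w₀ : Ω → Fin n → EuclideanSpace ℝ (Fin p))
    (x d y w : ℕ → Ω → Fin n → EuclideanSpace ℝ (Fin p)) : Prop where
  noise_init : IsNoise P m₀ σ fun i ω => w₀ ω i
  noise : ∀ t, IsNoise P (m t) σ fun i ω => w t ω i
  measurable_x : ∀ t i, Measurable[m t] fun ω => x t ω i
  memLp_x : ∀ t i, MemLp (fun ω => x t ω i) 2 P
  memLp_d : ∀ t i, MemLp (fun ω => d t ω i) 2 P
  x_zero : ∀ ω i, x 0 ω i = xinit i - η • (gradient (f i) (xinit i) + w₀ ω i)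
  d_zero : ∀ ω i, d 0 ω i = 0
  y_eq : ∀ t ω i, y t ω i = x t ω i - η • (gradient (f i) (x t ω i) + w t ω i) - d t ω i
  x_succ : ∀ t ω i, x (t + 1) ω i = y t ω i - (1 / 4 : ℝ) • (y t ω i - ∑ j, W i j • y t ω j)
  d_succ : ∀ t ω i, d (t + 1) ω i = d t ω i + (1 / 4 : ℝ) • (y t ω i - ∑ j, W i j • y t ω j)

variable {W : Matrix (Fin n) (Fin n) ℝ} {f : Fin n → EuclideanSpace ℝ (Fin p) → ℝ} {η σ : ℝ}
  {xinit : Fin n → EuclideanSpace ℝ (Fin p)} {m₀ : MeasurableSpace Ω}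
  {m : ℕ → MeasurableSpace Ω} {w₀ : Ω → Fin n → EuclideanSpace ℝ (Fin p)}
  {x d y w : ℕ → Ω → Fin n → EuclideanSpace ℝ (Fin p)}
  {L ν : ℝ} {fInf : Fin n → ℝ} {u : Fin n → Fin n → ℝ} {μ : Fin n → ℝ} {a₀ : Fin n}

theorem IsRun.sum_d_eq_zero (hr : IsRun P W f η σ xinit m₀ m w₀ x d y w)
    (hcol : ∀ j, ∑ i, W i j = 1) (t : ℕ) (ω : Ω) : ∑ i, d t ω i = 0 := by
  induction t with
  | zero => simp [hr.d_zero]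
  | succ t ih =>
    exact (sum_avg_of_step hcol ih (hr.y_eq t ω) (hr.x_succ t ω) (hr.d_succ t ω)).1

theorem IsRun.avg_succ (hr : IsRun P W f η σ xinit m₀ m w₀ x d y w)
    (hcol : ∀ j, ∑ i, W i j = 1) (t : ℕ) (ω : Ω) :
    avg (x (t + 1) ω)
      = avg (x t ω) - η • avg (fun i => gradient (f i) (x t ω i) + w t ω i) :=
  (sum_avg_of_step hcol (hr.sum_d_eq_zero hcol t ω) (hr.y_eq t ω) (hr.x_succ t ω)
    (hr.d_succ t ω)).2

/-- Telescoped descent of the objective along a run. -/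
theorem IsRun.descent_sum (hr : IsRun P W f η σ xinit m₀ m w₀ x d y w)
    (hcol : ∀ j, ∑ i, W i j = 1) (hn : n ≠ 0) (h : IsSmoothBelow L f fInf) (hη : 0 < η) (K : ℕ)
    (ω : Ω) :
    avg fInf - objective f (avg xinit) ≤ descentBound f L η xinit (w₀ ω)
      + ∑ t ∈ Finset.range K, descentBound f L η (x t ω) (w t ω) := by
  suffices h' : objective f (avg (x K ω)) - objective f (avg xinit)
      ≤ descentBound f L η xinit (w₀ ω)
      + ∑ t ∈ Finset.range K, descentBound f L η (x t ω) (w t ω) by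
    linarith [h.avg_le_objective (avg (x K ω))]
  induction K with
  | zero =>
    -- The initialization is itself a noisy gradient step, so the telescoping starts at `xinit`, one
    -- step before index `0`.
    have h0 : avg (x 0 ω)
        = avg xinit - η • avg (fun i => gradient (f i) (xinit i) + w₀ ω i) := by
      rw [funext (hr.x_zero ω), avg_sub, avg_smul]
    have h1 := h.descent hn hη xinit (w₀ ω)
    rw [h0, Finset.sum_range_zero, descentBound]
    linarith
  | succ k ih =>
    have h1 := h.descent hn hη (x k ω) (w k ω)
    rw [Finset.sum_range_succ, hr.avg_succ hcol]
    have h2 : descentBound f L η (x k ω) (w k ω) = _ := rfl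
    conv_rhs at h2 => rw [descentBound]
    linarith

variable [IsProbabilityMeasure P]

theorem energy_nonneg_terms (hu : IsModeSystem W ν u μ a₀) (hβ : 0 < 1 - ν)
    (z : Fin n → EuclideanSpace ℝ (Fin p)) :
    0 ≤ ∑ a ∈ Finset.univ.erase a₀, dualWeight (μ a) * ‖coef u a z‖ ^ 2 :=
  Finset.sum_nonneg fun a ha => mul_nonneg (dualWeight_nonneg (hu.neg_one_le a)
    (by linarith [hu.le a (Finset.ne_of_mem_erase ha)])) (sq_nonneg _)

theorem IsModeSystem.sum_norm_sub_avg_le_energy (hu : IsModeSystem W ν u μ a₀) (hn : n ≠ 0)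
    (hβ : 0 < 1 - ν) (x z : Fin n → EuclideanSpace ℝ (Fin p)) :
    ∑ i, ‖x i - avg x‖ ^ 2 ≤ energy u μ a₀ x z := by
  rw [hu.sum_norm_sub_avg hn, energy, Finset.sum_add_distrib]
  linarith [energy_nonneg_terms hu hβ z]

theorem IsModeSystem.energy_le (hu : IsModeSystem W ν u μ a₀) (hβ : 0 < 1 - ν)
    (x z : Fin n → EuclideanSpace ℝ (Fin p)) :
    energy u μ a₀ x z ≤ ∑ i, ‖x i‖ ^ 2 + 4 / (1 - ν) * ∑ i, ‖z i‖ ^ 2 := by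
  rw [energy, Finset.sum_add_distrib]
  have h1 := hu.sum_erase_norm_coef_le x
  have h2 : ∑ a ∈ Finset.univ.erase a₀, dualWeight (μ a) * ‖coef u a z‖ ^ 2
      ≤ 4 / (1 - ν) * ∑ i, ‖z i‖ ^ 2 := by
    calc _ ≤ ∑ a ∈ Finset.univ.erase a₀, 4 / (1 - ν) * ‖coef u a z‖ ^ 2 := by
          refine Finset.sum_le_sum fun a ha => ?_
          gcongr
          exact dualWeight_le (by linarith [hu.le a (Finset.ne_of_mem_erase ha)]) hβ
      _ ≤ _ := by
          rw [← Finset.mul_sum]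
          exact mul_le_mul_of_nonneg_left (hu.sum_erase_norm_coef_le z) (by positivity)
  linarith

/-- The expected energy of a run. -/
noncomputable def meanEnergy (P : Measure Ω) (f : Fin n → EuclideanSpace ℝ (Fin p) → ℝ) (η : ℝ)
    (u : Fin n → Fin n → ℝ) (μ : Fin n → ℝ) (a₀ : Fin n)
    (x d : Ω → Fin n → EuclideanSpace ℝ (Fin p)) : ℝ :=
  ∫ ω, energy u μ a₀ (x ω) (fun i => d ω i + η • gradient (f i) (avg (x ω))) ∂P

theorem IsRun.integrable_energy (hr : IsRun P W f η σ xinit m₀ m w₀ x d y w)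
    (h : IsSmoothBelow L f fInf) (t : ℕ) :
    Integrable (fun ω => energy u μ a₀ (x t ω)
      (fun i => d t ω i + η • gradient (f i) (avg (x t ω)))) P :=
  CEDAS.integrable_energy u μ a₀ (hr.memLp_x t) fun i => (hr.memLp_d t i).add
    ((h.memLp_gradient i (memLp_avg (hr.memLp_x t))).const_smul η)

/-- With `τ = ηL`, this is the size of the drift feedback, where `1152 = 16 · 72`. The first bound
makes its noise part a centralized term, the second lets the descent absorb its gradient part. -/
theorem quartic_le {τ β : ℝ} (hτ : 0 ≤ τ) (hβ : 0 < β) (hβ2 : β ≤ 2)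
    (h : 512 * τ ^ 2 ≤ β ^ 2) : 1152 * τ ^ 4 / β ^ 3 ≤ τ ∧ 1152 * τ ^ 4 / β ^ 3 + τ ≤ 1 := by
  have h1 : τ ≤ β / 22 := by
    rw [← abs_of_nonneg hτ, ← abs_of_nonneg (show 0 ≤ β / 22 by positivity)]
    apply sq_le_sq.1
    nlinarith
  have h2 : τ ^ 3 ≤ (β / 22) ^ 3 := pow_le_pow_left₀ hτ h1 3
  have h3 : 1152 * τ ^ 4 / β ^ 3 ≤ τ := by
    rw [div_le_iff₀ (by positivity)]
    have h4 := mul_le_mul_of_nonneg_left h2 hτ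
    have h5 : 0 ≤ τ * β ^ 3 := by positivity
    nlinarith
  exact ⟨h3, by linarith⟩

/-- The convergence bound of a run in terms of its initial energy. -/
theorem IsRun.sum_gradient_le (hr : IsRun P W f η σ xinit m₀ m w₀ x d y w) (hn : n ≠ 0)
    (h : IsSmoothBelow L f fInf) (hu : IsModeSystem W ν u μ a₀) (hs : ∀ i j, W i j = W j i)
    (hcol : ∀ j, ∑ i, W i j = 1) (hβ : 0 < 1 - ν) (hν : -1 ≤ ν) (hL : 0 < L) (hη : 0 < η)
    (hτ : 512 * (η * L) ^ 2 ≤ (1 - ν) ^ 2) (K : ℕ) :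
    ∑ t ∈ Finset.range K, ∫ ω, ‖gradient (objective f) (avg (x t ω))‖ ^ 2 ∂P
      ≤ 2 / η * (objective f (avg xinit) - avg fInf)
        + L ^ 2 / n * ∑ i, ‖xinit i - avg xinit‖ ^ 2
        + L * η * (σ ^ 2 / n)
        + 16 * L ^ 2 / (n * (1 - ν)) * meanEnergy P f η u μ a₀ (x 0) (d 0)
        + 16 * L ^ 2 / (1 - ν) * (K * η ^ 2 * σ ^ 2)
        + 2 * K * L * η * (σ ^ 2 / n) := by
  have hn' : (0 : ℝ) < n := by positivity
  set β := 1 - ν with hβdef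
  have hβ2 : β ≤ 2 := by linarith
  set V : ℕ → ℝ := fun t => meanEnergy P f η u μ a₀ (x t) (d t) with hVdef
  set M : ℕ → ℝ := fun t => ∫ ω, ‖avg fun i => gradient (f i) (x t ω i)‖ ^ 2 ∂P with hMdef
  set Γ : ℕ → ℝ := fun t => ∫ ω, ‖gradient (objective f) (avg (x t ω))‖ ^ 2 ∂P with hΓdef
  set E : ℕ → ℝ := fun t => ∫ ω, ∑ i, ‖x t ω i - avg (x t ω)‖ ^ 2 ∂P with hEdef
  have hM0 : ∀ t, 0 ≤ M t := fun t => integral_nonneg fun _ => sq_nonneg _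
  have hEV : ∀ t, E t ≤ V t := fun t =>
    integral_mono (integrable_sum_norm_sq (memLp_sub_avg (hr.memLp_x t)))
      (hr.integrable_energy h t) fun ω => hu.sum_norm_sub_avg_le_energy hn hβ _ _
  have hE0 : ∀ t, 0 ≤ E t := fun t =>
    integral_nonneg fun _ => Finset.sum_nonneg fun _ _ => sq_nonneg _
  have hstep : ∀ t, V (t + 1) ≤ (1 - β / 16) * V t
      + (η ^ 2 * (n * σ ^ 2) + 72 / β ^ 2 * (n * L ^ 2 * η ^ 4) * (σ ^ 2 / n))
      + 72 / β ^ 2 * (n * L ^ 2 * η ^ 4) * M t := by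
    intro t
    have := (hr.noise t).integral_energy_step hn h (hr.measurable_x t) (hr.memLp_x t) hu hs hcol
      hβ hν hL hη hτ (hr.memLp_d t) (hr.memLp_x (t + 1)) (hr.memLp_d (t + 1))
      (hr.sum_d_eq_zero hcol t) (hr.y_eq t) (hr.x_succ t) (hr.d_succ t)
    change V (t + 1) ≤ (1 - β / 16) * V t + _ + 72 / β ^ 2 * (n * L ^ 2 * η ^ 4 * (M t + _)) at this
    linarith
  have hsum := sum_le_of_contraction (fun t => (hE0 t).trans (hEV t)) hstep K
  have hdesc : ∀ t, Integrable (fun ω => descentBound f L η (x t ω) (w t ω)) P ∧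
      ∫ ω, descentBound f L η (x t ω) (w t ω) ∂P ≤ η * L ^ 2 / (2 * n) * E t
        + L / 2 * η ^ 2 * (σ ^ 2 / n) - η / 2 * Γ t - η / 2 * (1 - η * L) * M t := fun t =>
    (hr.noise t).integral_descentBound_le hn hL h (hr.measurable_x t) (hr.memLp_x t)
  have hinit := hr.noise_init.integral_descentBound_le (η := η) hn hL h
    (x := fun _ => xinit) (fun i => @measurable_const _ _ _ m₀ _) (fun i => memLp_const _)
  obtain ⟨q1, q2⟩ := quartic_le (mul_pos hη hL).le hβ hβ2 hτ
  have hq0 : 0 ≤ 1152 * (η * L) ^ 4 / β ^ 3 := by positivity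
  have hτ1 : 0 ≤ 1 - η * L := by linarith
  have hi := integral_mono (integrable_const _)
    (hinit.1.add (integrable_finsetSum (Finset.range K) fun t _ => (hdesc t).1))
    (hr.descent_sum hcol hn h hη K)
  simp only [Pi.add_apply] at hi
  rw [integral_add hinit.1 (integrable_finsetSum (Finset.range K) fun t _ => (hdesc t).1),
    integral_finsetSum _ fun t _ => (hdesc t).1] at hi
  have hinit2 := hinit.2
  simp only [integral_const, probReal_univ, one_smul] at hi hinit2
  have hdsum := Finset.sum_le_sum fun t (_ : t ∈ Finset.range K) => (hdesc t).2
  simp only [Finset.sum_sub_distrib, Finset.sum_add_distrib, ← Finset.mul_sum, Finset.sum_const,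
    Finset.card_range, nsmul_eq_mul] at hdsum
  set SV := ∑ t ∈ Finset.range K, V t
  set SM := ∑ t ∈ Finset.range K, M t
  set SΓ := ∑ t ∈ Finset.range K, Γ t
  set SE := ∑ t ∈ Finset.range K, E t
  have hSE : SE ≤ SV := Finset.sum_le_sum fun t _ => hEV t
  have hSM : 0 ≤ SM := Finset.sum_nonneg fun t _ => hM0 t
  have hV0 : SV ≤ 16 / β * (V 0
      + K * (η ^ 2 * (n * σ ^ 2) + 72 / β ^ 2 * (n * L ^ 2 * η ^ 4) * (σ ^ 2 / n))
      + 72 / β ^ 2 * (n * L ^ 2 * η ^ 4) * SM) := by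
    have := mul_le_mul_of_nonneg_left hsum (show 0 ≤ 16 / β by positivity)
    rwa [show 16 / β * (β / 16 * SV) = SV by field_simp] at this
  -- The accumulated consensus error depends on `SM`, which itself appears with a negative sign in
  -- the descent; the loop is closed by `c1` and `c2`.
  have hcons : L ^ 2 / n * SE ≤ 16 * L ^ 2 / (n * β) * V 0
      + 16 * L ^ 2 / β * (K * η ^ 2 * σ ^ 2)
      + 1152 * (η * L) ^ 4 / β ^ 3 * (K * (σ ^ 2 / n) + SM) := by
    have h1 := mul_le_mul_of_nonneg_left (hSE.trans hV0) (show 0 ≤ L ^ 2 / n by positivity)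
    refine h1.trans_eq ?_
    field_simp
    ring
  have b1 : 0 ≤ η / 2 * (∫ ω, ‖gradient (objective f) (avg xinit)‖ ^ 2 ∂P) := by
    have : 0 ≤ ∫ ω, ‖gradient (objective f) (avg xinit)‖ ^ 2 ∂P :=
      integral_nonneg fun _ => sq_nonneg _
    positivity
  simp only [integral_const, probReal_univ, one_smul] at b1
  have b2 : 0 ≤ η / 2 * (1 - η * L) * ‖avg fun i => gradient (f i) (xinit i)‖ ^ 2 := by
    positivity
  have hmain : η / 2 * SΓ + η / 2 * (1 - η * L) * SM
      ≤ (objective f (avg xinit) - avg fInf)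
        + η * L ^ 2 / (2 * n) * ∑ i, ‖xinit i - avg xinit‖ ^ 2
        + L / 2 * η ^ 2 * (σ ^ 2 / n) + η * L ^ 2 / (2 * n) * SE
        + K * (L / 2 * η ^ 2 * (σ ^ 2 / n)) := by
    linarith
  have hmain2 := mul_le_mul_of_nonneg_left hmain (show 0 ≤ 2 / η by positivity)
  have e1 : 2 / η * (η / 2 * SΓ + η / 2 * (1 - η * L) * SM) = SΓ + (1 - η * L) * SM := by
    field_simp
  have e2 : 2 / η * ((objective f (avg xinit) - avg fInf)
        + η * L ^ 2 / (2 * n) * ∑ i, ‖xinit i - avg xinit‖ ^ 2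
        + L / 2 * η ^ 2 * (σ ^ 2 / n) + η * L ^ 2 / (2 * n) * SE
        + K * (L / 2 * η ^ 2 * (σ ^ 2 / n)))
      = 2 / η * (objective f (avg xinit) - avg fInf)
        + L ^ 2 / n * ∑ i, ‖xinit i - avg xinit‖ ^ 2
        + L * η * (σ ^ 2 / n) + L ^ 2 / n * SE + K * L * η * (σ ^ 2 / n) := by
    field_simp
  rw [e1, e2] at hmain2
  have c1 : 1152 * (η * L) ^ 4 / β ^ 3 * (K * (σ ^ 2 / n)) ≤ η * L * (K * (σ ^ 2 / n)) := by
    gcongr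
  have c2 : 1152 * (η * L) ^ 4 / β ^ 3 * SM ≤ (1 - η * L) * SM := by
    gcongr
    linarith
  rw [mul_add (1152 * (η * L) ^ 4 / β ^ 3)] at hcons
  linarith

/-- The initial energy is controlled by the initial data. -/
theorem IsRun.meanEnergy_zero_le (hr : IsRun P W f η σ xinit m₀ m w₀ x d y w) (hn : n ≠ 0)
    (h : IsSmoothBelow L f fInf) (hu : IsModeSystem W ν u μ a₀)
    (hβ : 0 < 1 - ν) (hν : -1 ≤ ν) (hL : 0 < L)
    (hτ : 512 * (η * L) ^ 2 ≤ (1 - ν) ^ 2) :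
    meanEnergy P f η u μ a₀ (x 0) (d 0) ≤ 7 * ∑ i, ‖xinit i‖ ^ 2
      + 7 / L ^ 2 * ∑ i, ‖gradient (f i) (xinit i)‖ ^ 2 + 6 / L ^ 2 * (n * σ ^ 2) := by
  have hn' : (0 : ℝ) < n := by positivity
  set β := 1 - ν with hβdef
  have hβ2 : β ≤ 2 := by linarith
  set X := ∑ i, ‖xinit i‖ ^ 2
  set D := ∑ i, ‖gradient (f i) (xinit i)‖ ^ 2
  have hX0 : 0 ≤ X := Finset.sum_nonneg fun _ _ => sq_nonneg _
  have hD0 : 0 ≤ D := Finset.sum_nonneg fun _ _ => sq_nonneg _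
  have hsq2 : ∀ a b : EuclideanSpace ℝ (Fin p), ‖a + b‖ ^ 2 ≤ 2 * ‖a‖ ^ 2 + 2 * ‖b‖ ^ 2 := by
    intro a b
    have := norm_add_sq_le_young a b one_pos
    norm_num at this
    linarith
  have hx0 : ∀ ω, ∑ i, ‖x 0 ω i‖ ^ 2 ≤ 3 * (X + η ^ 2 * D + η ^ 2 * ∑ i, ‖w₀ ω i‖ ^ 2) := by
    intro ω
    rw [show 3 * (X + η ^ 2 * D + η ^ 2 * ∑ i, ‖w₀ ω i‖ ^ 2) = ∑ i, 3 * (‖xinit i‖ ^ 2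
        + η ^ 2 * ‖gradient (f i) (xinit i)‖ ^ 2 + η ^ 2 * ‖w₀ ω i‖ ^ 2) by
      simp only [X, D, Finset.mul_sum, ← Finset.sum_add_distrib]]
    refine Finset.sum_le_sum fun i _ => ?_
    have h1 : ‖x 0 ω i‖ ≤ ‖xinit i‖ + (|η| * ‖gradient (f i) (xinit i)‖ + |η| * ‖w₀ ω i‖) := by
      rw [hr.x_zero]
      refine (norm_sub_le _ _).trans ?_
      rw [norm_smul, Real.norm_eq_abs, ← mul_add]
      gcongr
      exact norm_add_le _ _
    have h2 := pow_le_pow_left₀ (norm_nonneg _) h1 2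
    refine h2.trans ?_
    rw [← sq_abs η]
    nlinarith [sq_nonneg (‖xinit i‖ - |η| * ‖gradient (f i) (xinit i)‖),
      sq_nonneg (‖xinit i‖ - |η| * ‖w₀ ω i‖),
      sq_nonneg (|η| * ‖gradient (f i) (xinit i)‖ - |η| * ‖w₀ ω i‖)]
  have hz0 : ∀ ω, ∑ i, ‖gradient (f i) (avg (x 0 ω))‖ ^ 2
      ≤ 2 * D + 4 * L ^ 2 * ∑ i, ‖x 0 ω i‖ ^ 2 + 4 * L ^ 2 * X := by
    intro ω
    have h1 : ∀ i, ‖gradient (f i) (avg (x 0 ω))‖ ^ 2 ≤ 2 * ‖gradient (f i) (xinit i)‖ ^ 2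
        + 4 * L ^ 2 * ‖avg (x 0 ω)‖ ^ 2 + 4 * L ^ 2 * ‖xinit i‖ ^ 2 := by
      intro i
      have a1 := hsq2 (gradient (f i) (xinit i))
        (gradient (f i) (avg (x 0 ω)) - gradient (f i) (xinit i))
      rw [add_sub_cancel] at a1
      have a2 := pow_le_pow_left₀ (norm_nonneg _) (h.lipschitz i (avg (x 0 ω)) (xinit i)) 2
      have a3 := hsq2 (avg (x 0 ω)) (-xinit i)
      rw [← sub_eq_add_neg, norm_neg] at a3
      have a4 := mul_le_mul_of_nonneg_left a3 (sq_nonneg L)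
      rw [mul_pow] at a2
      linarith
    have h2 := Finset.sum_le_sum fun i (_ : i ∈ Finset.univ) => h1 i
    simp only [Finset.sum_add_distrib, ← Finset.mul_sum, Finset.sum_const, Finset.card_univ,
      Fintype.card_fin, nsmul_eq_mul] at h2
    have h3 := mul_le_mul_of_nonneg_left (norm_avg_sq_le hn (x 0 ω))
      (show 0 ≤ 4 * L ^ 2 * n by positivity)
    rw [show 4 * L ^ 2 * (n : ℝ) * ((n : ℝ)⁻¹ * ∑ i, ‖x 0 ω i‖ ^ 2)
      = 4 * L ^ 2 * ∑ i, ‖x 0 ω i‖ ^ 2 by field_simp] at h3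
    change _ ≤ 2 * D + _ + 4 * L ^ 2 * X at h2
    linarith
  set c := 4 / β * η ^ 2 with hc
  have hc0 : 0 ≤ c := by positivity
  -- `c L² = 4 (ηL)²/β ≤ β/128`, and `β ≤ 2`: the stepsize condition removes the factor `1/β` of the
  -- dual weight.
  have hcL : c * L ^ 2 ≤ 1 / 64 := by
    have : c * L ^ 2 = 4 * (η * L) ^ 2 / β := by rw [hc]; ring
    rw [this, div_le_iff₀ hβ]
    nlinarith
  have hηL : η ^ 2 ≤ 1 / L ^ 2 := by
    rw [le_div_iff₀ (by positivity)]
    nlinarith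
  have hcL' : c ≤ 1 / 64 * (1 / L ^ 2) := by
    rw [mul_one_div, le_div_iff₀ (by positivity)]
    exact hcL
  have hpath : ∀ ω, energy u μ a₀ (x 0 ω)
      (fun i => d 0 ω i + η • gradient (f i) (avg (x 0 ω)))
      ≤ 7 * X + 7 / L ^ 2 * D + 6 / L ^ 2 * ∑ i, ‖w₀ ω i‖ ^ 2 := by
    intro ω
    have h1 := hu.energy_le hβ (x 0 ω) (fun i => d 0 ω i + η • gradient (f i) (avg (x 0 ω)))
    have h2 : 4 / β * ∑ i, ‖d 0 ω i + η • gradient (f i) (avg (x 0 ω))‖ ^ 2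
        = c * ∑ i, ‖gradient (f i) (avg (x 0 ω))‖ ^ 2 := by
      rw [hc, mul_assoc, Finset.mul_sum (a := η ^ 2)]
      congr 1
      refine Finset.sum_congr rfl fun i _ => ?_
      rw [hr.d_zero, zero_add, norm_smul, mul_pow, Real.norm_eq_abs, sq_abs]
    have h3 := mul_le_mul_of_nonneg_left (hz0 ω) hc0
    set N := ∑ i, ‖w₀ ω i‖ ^ 2
    have hN : 0 ≤ N := Finset.sum_nonneg fun _ _ => sq_nonneg _
    set Y := ∑ i, ‖x 0 ω i‖ ^ 2
    have hY : 0 ≤ Y := Finset.sum_nonneg fun _ _ => sq_nonneg _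
    have h4 := mul_le_mul_of_nonneg_right hcL (show 0 ≤ 4 * (Y + X) by positivity)
    have h5 := mul_le_mul_of_nonneg_right hcL' (show 0 ≤ 2 * D by positivity)
    have h6 := mul_le_mul_of_nonneg_right hηL hD0
    have h7 := mul_le_mul_of_nonneg_right hηL hN
    have h8 := hx0 ω
    have h9 : 0 ≤ 1 / L ^ 2 * D := by positivity
    have h10 : 0 ≤ 1 / L ^ 2 * N := by positivity
    have e1 : 7 / L ^ 2 * D = 7 * (1 / L ^ 2 * D) := by ring
    have e2 : 6 / L ^ 2 * N = 6 * (1 / L ^ 2 * N) := by ring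
    rw [e1, e2]
    change energy _ _ _ _ _ ≤ Y + 4 / β * _ at h1
    rw [h2] at h1
    linarith
  have hi := integral_mono (hr.integrable_energy h 0) ((integrable_const _).add
    ((integrable_sum_norm_sq hr.noise_init.memLp).const_mul _)) hpath
  simp only [Pi.add_apply] at hi
  rw [integral_add (integrable_const _)
    ((integrable_sum_norm_sq hr.noise_init.memLp).const_mul _), integral_const_mul] at hi
  simp only [integral_const, probReal_univ, one_smul] at hi
  have := mul_le_mul_of_nonneg_left hr.noise_init.integral_sum_sq_le
    (show 0 ≤ 6 / L ^ 2 by positivity)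
  exact hi.trans (by linarith)

/-- The remainder constant of the rate. -/
noncomputable def rateConst (L σ cx cg : ℝ) : ℝ :=
  2 * L ^ 2 * cx + 16 * L ^ 2 * (7 * cx + 7 / L ^ 2 * cg + 6 / L ^ 2 * σ ^ 2)
    + 16 * L ^ 2 * σ ^ 2

/-- A run reaches the centralized rate once the horizon is of order `n ^ 3 / (1 - ν) ^ 2`. -/
theorem IsRun.rate {K : ℕ} {cx cg Δ : ℝ} (hn : n ≠ 0)
    (hr : IsRun P W f (Real.sqrt ((n : ℝ) / K)) σ xinit m₀ m w₀ x d y w)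
    (h : IsSmoothBelow L f fInf) (hu : IsModeSystem W ν u μ a₀) (hs : ∀ i j, W i j = W j i)
    (hcol : ∀ j, ∑ i, W i j = 1) (hβ : 0 < 1 - ν) (hν : -1 ≤ ν) (hL : 0 < L)
    (hΔ : objective f (avg xinit) - avg fInf ≤ Δ)
    (hcx : ∑ i, ‖xinit i‖ ^ 2 ≤ cx * (n : ℝ) ^ 2)
    (hcg : ∑ i, ‖gradient (f i) (xinit i)‖ ^ 2 ≤ cg * (n : ℝ) ^ 2)
    (hK0 : 512 * n * L ^ 2 / (1 - ν) ^ 2 ≤ K)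
    (hK1 : rateConst L σ cx cg ^ 2 * (n ^ 3 / (1 - ν) ^ 2) ≤ K) :
    (K : ℝ)⁻¹ * ∑ t ∈ Finset.range K, ∫ ω, ‖gradient (objective f) (avg (x t ω))‖ ^ 2 ∂P
      ≤ (2 * |Δ| + 3 * L * σ ^ 2 + 1) / Real.sqrt (n * K) := by
  have hn' : (0 : ℝ) < n := by positivity
  have hn1 : (1 : ℝ) ≤ n := by exact_mod_cast Nat.one_le_iff_ne_zero.2 hn
  set β := 1 - ν with hβdef
  have hβ2 : β ≤ 2 := by linarith
  have hK : (0 : ℝ) < K := lt_of_lt_of_le (by positivity) hK0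
  have hK1' : (1 : ℝ) ≤ K := by exact_mod_cast (by exact_mod_cast hK : 0 < K)
  set η := Real.sqrt ((n : ℝ) / K) with hηdef
  set s := Real.sqrt (n * K) with hsdef
  have hη : 0 < η := Real.sqrt_pos.2 (by positivity)
  have hs0 : 0 < s := Real.sqrt_pos.2 (by positivity)
  have hη2 : η ^ 2 = n / K := Real.sq_sqrt (by positivity)
  have hs2 : s ^ 2 = n * K := Real.sq_sqrt (by positivity)
  -- With this stepsize `1/(ηK)` and `η/n` are both `1/√(nK)`, which balances the two centralized
  -- terms.
  have hηK : η * K = s := by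
    rw [← abs_of_pos hs0, ← abs_of_pos (show 0 < η * K by positivity), ← sq_eq_sq_iff_abs_eq_abs,
      mul_pow, hη2, hs2]
    field_simp
  have hηs : η = n / s := by
    rw [eq_div_iff hs0.ne', ← hηK, ← mul_assoc, ← sq, hη2]
    field_simp
  have hτ : 512 * (η * L) ^ 2 ≤ β ^ 2 := by
    rw [div_le_iff₀ (by positivity)] at hK0
    rw [mul_pow, hη2, show 512 * ((n : ℝ) / K * L ^ 2) = 512 * n * L ^ 2 / K by ring,
      div_le_iff₀ hK]
    linarith
  have hmain := hr.sum_gradient_le hn h hu hs hcol hβ hν hL hη hτ K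
  have hV0 := hr.meanEnergy_zero_le hn h hu hβ hν hL hτ
  set V0 := meanEnergy P f η u μ a₀ (x 0) (d 0)
  set C0 := 7 * cx + 7 / L ^ 2 * cg + 6 / L ^ 2 * σ ^ 2 with hC0
  set Q := rateConst L σ cx cg with hQ
  have hcx0 : 0 ≤ cx := by
    have : 0 ≤ cx * (n : ℝ) ^ 2 := (Finset.sum_nonneg fun _ _ => sq_nonneg _).trans hcx
    exact nonneg_of_mul_nonneg_left this (by positivity)
  have hV1 : V0 ≤ C0 * n ^ 2 := by
    have a1 := mul_le_mul_of_nonneg_left hcg (show 0 ≤ 7 / L ^ 2 by positivity)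
    have a2 : 6 / L ^ 2 * (n * σ ^ 2) ≤ 6 / L ^ 2 * (n ^ 2 * σ ^ 2) := by
      gcongr
      nlinarith
    rw [hC0]
    linarith
  have hE : ∑ i, ‖xinit i - avg xinit‖ ^ 2 ≤ cx * (n : ℝ) ^ 2 :=
    (hu.sum_norm_sub_avg hn xinit).le.trans ((hu.sum_erase_norm_coef_le xinit).trans hcx)
  have t1 : (K : ℝ)⁻¹ * (2 / η * (objective f (avg xinit) - avg fInf)) ≤ 2 * |Δ| / s := by
    rw [← hηK, show (K : ℝ)⁻¹ * (2 / η * (objective f (avg xinit) - avg fInf))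
      = 2 * (objective f (avg xinit) - avg fInf) / (η * K) by field_simp]
    gcongr
    exact hΔ.trans (le_abs_self Δ)
  have t2 : (K : ℝ)⁻¹ * (L ^ 2 / n * ∑ i, ‖xinit i - avg xinit‖ ^ 2)
      ≤ n / (K * β) * (2 * L ^ 2 * cx) := by
    calc (K : ℝ)⁻¹ * (L ^ 2 / n * ∑ i, ‖xinit i - avg xinit‖ ^ 2)
        ≤ (K : ℝ)⁻¹ * (L ^ 2 / n * (cx * (n : ℝ) ^ 2)) := by gcongr
      _ = n / (K * β) * (β * L ^ 2 * cx) := by field_simp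
      _ ≤ _ := by gcongr
  have t3 : (K : ℝ)⁻¹ * (L * η * (σ ^ 2 / n)) ≤ L * σ ^ 2 / s := by
    rw [hηs, show L * (n / s) * (σ ^ 2 / n) = L * σ ^ 2 / s by field_simp]
    exact mul_le_of_le_one_left (by positivity) (inv_le_one_of_one_le₀ hK1')
  have t4 : (K : ℝ)⁻¹ * (16 * L ^ 2 / (n * β) * V0) ≤ n / (K * β) * (16 * L ^ 2 * C0) := by
    calc (K : ℝ)⁻¹ * (16 * L ^ 2 / (n * β) * V0)
        ≤ (K : ℝ)⁻¹ * (16 * L ^ 2 / (n * β) * (C0 * n ^ 2)) := by gcongr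
      _ = _ := by field_simp
  have t5 : (K : ℝ)⁻¹ * (16 * L ^ 2 / β * (K * η ^ 2 * σ ^ 2))
      = n / (K * β) * (16 * L ^ 2 * σ ^ 2) := by
    rw [hη2]
    field_simp
  have t6 : (K : ℝ)⁻¹ * (2 * K * L * η * (σ ^ 2 / n)) = 2 * L * σ ^ 2 / s := by
    rw [hηs]
    field_simp
  -- Squaring turns this into `Q² n³ ≤ K β²`, which is where the order `n³/β²` originates.
  have hQs : n / (K * β) * Q ≤ 1 / s := by
    rw [div_mul_eq_mul_div, div_le_div_iff₀ (by positivity) hs0, one_mul]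
    refine abs_le_of_sq_le_sq' ?_ (by positivity) |>.2
    rw [← mul_div_assoc, div_le_iff₀ (by positivity)] at hK1
    rw [mul_pow, hs2]
    have := mul_le_mul_of_nonneg_right hK1 hK.le
    linarith
  have hfin := mul_le_mul_of_nonneg_left hmain (inv_nonneg.2 hK.le)
  refine hfin.trans ?_
  simp only [mul_add (K : ℝ)⁻¹]
  have hQ' : n / (K * β) * Q = n / (K * β) * (2 * L ^ 2 * cx) + n / (K * β) * (16 * L ^ 2 * C0)
      + n / (K * β) * (16 * L ^ 2 * σ ^ 2) := by
    rw [hQ, rateConst]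
    ring
  have hA : (2 * |Δ| + 3 * L * σ ^ 2 + 1) / s
      = 2 * |Δ| / s + L * σ ^ 2 / s + 2 * L * σ ^ 2 / s + 1 / s := by
    ring
  rw [hA]
  linarith

end Run

end CEDAS

namespace CEDAS

/-! ### Reduction of the algorithm to an exact run. -/

section Algorithm

theorem step_congr {n p : ℕ} {W : Matrix (Fin n) (Fin n) ℝ} {α γ η : ℝ}
    {Q Q' : Fin n → EuclideanSpace ℝ (Fin p) → EuclideanSpace ℝ (Fin p)}
    {G : Fin n → EuclideanSpace ℝ (Fin p)} {s : State n p}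
    (h : ∀ i, Q i (s.x i - η • G i - s.d i - s.h i) = Q' i (s.x i - η • G i - s.d i - s.h i)) :
    step W α γ η Q G s = step W α γ η Q' G s := by
  simp only [step, h]

variable {n p : ℕ} {Ω Ξ Z : Type*} {W : Matrix (Fin n) (Fin n) ℝ} {α γ : ℝ} {η : ℕ → ℝ}
  {g : Fin n → EuclideanSpace ℝ (Fin p) → Ξ → EuclideanSpace ℝ (Fin p)} {ξ : Fin n → ℕ → Ω → Ξ}
  {𝒞 : EuclideanSpace ℝ (Fin p) → Z → EuclideanSpace ℝ (Fin p)} {ζ : Fin n → ℕ → Ω → Z}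
  {xinit h0 : Fin n → EuclideanSpace ℝ (Fin p)}

/-- Because of this invariant, the reference points `h` cancel in `ŷ - ŷ_w` when compression is
exact, leaving `y - W y`. -/
theorem cedas_hw (k : ℕ) (ω : Ω) (i : Fin n) :
    (cedas W α γ η g ξ 𝒞 ζ xinit h0 k ω).hw i
      = ∑ j, W i j • (cedas W α γ η g ξ 𝒞 ζ xinit h0 k ω).h j := by
  induction k with
  | zero => rfl
  | succ k ih =>
    simp only [cedas, step]
    rw [ih]
    simp only [smul_add, Finset.sum_add_distrib, ← smul_comm (1 - α), ← smul_comm α,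
      ← Finset.smul_sum]

/-- The algorithm with the identity as compression operator. -/
noncomputable def exactCedas (W : Matrix (Fin n) (Fin n) ℝ) (η : ℝ)
    (g : Fin n → EuclideanSpace ℝ (Fin p) → Ξ → EuclideanSpace ℝ (Fin p))
    (ξ : Fin n → ℕ → Ω → Ξ) (xinit h0 : Fin n → EuclideanSpace ℝ (Fin p)) (k : ℕ) (ω : Ω) :
    State n p :=
  cedas W 1 (1 / 2) (fun _ => η) g ξ (fun v (_ : Unit) => v) (fun _ _ _ => ()) xinit h0 k ω

/-- The gradient noise of the exact algorithm. -/
noncomputable def exactNoise (W : Matrix (Fin n) (Fin n) ℝ) (η : ℝ)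
    (g : Fin n → EuclideanSpace ℝ (Fin p) → Ξ → EuclideanSpace ℝ (Fin p))
    (ξ : Fin n → ℕ → Ω → Ξ) (xinit h0 : Fin n → EuclideanSpace ℝ (Fin p))
    (f : Fin n → EuclideanSpace ℝ (Fin p) → ℝ) (k : ℕ) (ω : Ω) (i : Fin n) :
    EuclideanSpace ℝ (Fin p) :=
  g i ((exactCedas W η g ξ xinit h0 k ω).x i) (ξ i (k + 1) ω)
    - gradient (f i) ((exactCedas W η g ξ xinit h0 k ω).x i)

/-- The variables `y` of the exact algorithm. -/
noncomputable def exactY (W : Matrix (Fin n) (Fin n) ℝ) (η : ℝ)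
    (g : Fin n → EuclideanSpace ℝ (Fin p) → Ξ → EuclideanSpace ℝ (Fin p))
    (ξ : Fin n → ℕ → Ω → Ξ) (xinit h0 : Fin n → EuclideanSpace ℝ (Fin p)) (k : ℕ) (ω : Ω)
    (i : Fin n) : EuclideanSpace ℝ (Fin p) :=
  (exactCedas W η g ξ xinit h0 k ω).x i
    - η • g i ((exactCedas W η g ξ xinit h0 k ω).x i) (ξ i (k + 1) ω)
    - (exactCedas W η g ξ xinit h0 k ω).d i

variable {η : ℝ}

theorem exactCedas_succ (k : ℕ) (ω : Ω) :
    exactCedas W η g ξ xinit h0 (k + 1) ω = step W 1 (1 / 2) η (fun _ v => v)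
      (fun i => g i ((exactCedas W η g ξ xinit h0 k ω).x i) (ξ i (k + 1) ω))
      (exactCedas W η g ξ xinit h0 k ω) := rfl

theorem exactCedas_d_succ (k : ℕ) (ω : Ω) (i : Fin n) :
    (exactCedas W η g ξ xinit h0 (k + 1) ω).d i = (exactCedas W η g ξ xinit h0 k ω).d i
      + (1 / 4 : ℝ) • (exactY W η g ξ xinit h0 k ω i
        - ∑ j, W i j • exactY W η g ξ xinit h0 k ω j) := by
  have hw := cedas_hw (W := W) (α := 1) (γ := 1 / 2) (η := fun _ => η) (g := g) (ξ := ξ)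
    (𝒞 := fun v (_ : Unit) => v) (ζ := fun _ _ _ => ()) (xinit := xinit) (h0 := h0) k ω i
  simp only [exactCedas, cedas, step, exactY]
  rw [hw, ← Finset.sum_add_distrib]
  simp only [← smul_add, add_sub_cancel]
  norm_num

theorem exactCedas_x_succ (k : ℕ) (ω : Ω) (i : Fin n) :
    (exactCedas W η g ξ xinit h0 (k + 1) ω).x i = exactY W η g ξ xinit h0 k ω i
      - (1 / 4 : ℝ) • (exactY W η g ξ xinit h0 k ω i
        - ∑ j, W i j • exactY W η g ξ xinit h0 k ω j) := by
  have h1 : (exactCedas W η g ξ xinit h0 (k + 1) ω).x i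
      = (exactCedas W η g ξ xinit h0 k ω).x i
        - η • g i ((exactCedas W η g ξ xinit h0 k ω).x i) (ξ i (k + 1) ω)
        - (exactCedas W η g ξ xinit h0 (k + 1) ω).d i := rfl
  rw [h1, exactCedas_d_succ, ← sub_sub]
  rfl

theorem exactCedas_h_succ (k : ℕ) (ω : Ω) (i : Fin n) :
    (exactCedas W η g ξ xinit h0 (k + 1) ω).h i = exactY W η g ξ xinit h0 k ω i := by
  simp only [exactCedas, cedas, step, exactY]
  simp

section Measurability

variable [MeasurableSpace Ω] [MeasurableSpace Ξ]

theorem measurable_exactY (hg : ∀ i, Measurable (Function.uncurry (g i))) {k : ℕ}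
    (hξ : ∀ i, Measurable (ξ i (k + 1)))
    (hx : ∀ i, Measurable fun ω => (exactCedas W η g ξ xinit h0 k ω).x i)
    (hd : ∀ i, Measurable fun ω => (exactCedas W η g ξ xinit h0 k ω).d i) (i : Fin n) :
    Measurable fun ω => exactY W η g ξ xinit h0 k ω i :=
  ((hx i).sub (((hg i).comp ((hx i).prodMk (hξ i))).const_smul η)).sub (hd i)

theorem measurable_exactCedas (hg : ∀ i, Measurable (Function.uncurry (g i))) (k : ℕ)
    (hξ : ∀ i, ∀ l ≤ k, Measurable (ξ i l)) :
    (∀ i, Measurable fun ω => (exactCedas W η g ξ xinit h0 k ω).x i) ∧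
    (∀ i, Measurable fun ω => (exactCedas W η g ξ xinit h0 k ω).d i) ∧
    ∀ i, Measurable fun ω => (exactCedas W η g ξ xinit h0 k ω).h i := by
  induction k with
  | zero =>
    refine ⟨fun i => ?_, fun i => measurable_const, fun i => measurable_const⟩
    exact measurable_const.sub (((hg i).comp
      (measurable_const.prodMk (hξ i 0 le_rfl))).const_smul η)
  | succ k ih =>
    obtain ⟨hx, hd, -⟩ := ih fun i l hl => hξ i l (hl.trans (Nat.le_succ k))
    have hy := measurable_exactY hg (fun i => hξ i (k + 1) le_rfl) hx hd
    simp only [exactCedas_x_succ, exactCedas_d_succ, exactCedas_h_succ]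
    refine ⟨fun i => ?_, fun i => ?_, hy⟩
    · fun_prop
    · exact (hd i).add (by fun_prop)

end Measurability

theorem measurable_past_exactCedas [MeasurableSpace Ξ]
    (hg : ∀ i, Measurable (Function.uncurry (g i)))
    {S : Set (Fin n × ℕ)} {k : ℕ} (hS : ∀ i, ∀ l ≤ k, (i, l) ∈ S) :
    (∀ i, Measurable[past ξ S] fun ω => (exactCedas W η g ξ xinit h0 k ω).x i) ∧
    (∀ i, Measurable[past ξ S] fun ω => (exactCedas W η g ξ xinit h0 k ω).d i) ∧
    ∀ i, Measurable[past ξ S] fun ω => (exactCedas W η g ξ xinit h0 k ω).h i :=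
  @measurable_exactCedas n p Ω Ξ W g ξ xinit h0 η (past ξ S) _ hg k
    fun i l hl => measurable_past (hS i l hl)

variable [mΩ : MeasurableSpace Ω] [MeasurableSpace Ξ] [MeasurableSpace Z] {P : Measure Ω}
  {f : Fin n → EuclideanSpace ℝ (Fin p) → ℝ} {fInf : Fin n → ℝ} {σ L : ℝ}
  [IsProbabilityMeasure P]

/-- Without compression error the algorithm almost surely coincides with the exact one. -/
theorem ae_cedas_eq_exactCedas (hg : ∀ i, Measurable (Function.uncurry (g i)))
    (hc : IsUnbiasedCompressor P 0 𝒞 ζ) (hi : IsIndependentNoise P ξ ζ) (k : ℕ) :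
    ∀ᵐ ω ∂P, cedas W 1 (1 / 2) (fun _ => η) g ξ 𝒞 ζ xinit h0 k ω
      = exactCedas W η g ξ xinit h0 k ω := by
  induction k with
  | zero => exact Filter.Eventually.of_forall fun ω => rfl
  | succ k ih =>
    obtain ⟨hx, hd, hh⟩ := measurable_past_exactCedas (W := W) (η := η) (xinit := xinit)
      (h0 := h0) (ξ := ξ) (S := Set.univ) (k := k) hg fun _ _ _ => Set.mem_univ _
    have hy := @measurable_exactY n p Ω Ξ W g ξ xinit h0 η (past ξ Set.univ) _ hg k
      (fun i => measurable_past (Set.mem_univ _)) hx hd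
    -- The compressor is evaluated at a point of the exact run, which is a function of gradient
    -- samples alone and so independent of `ζ i k`; the actual iterates also involve earlier
    -- compression samples.
    have hq : ∀ᵐ ω ∂P, ∀ i, 𝒞 (exactY W η g ξ xinit h0 k ω i
          - (exactCedas W η g ξ xinit h0 k ω).h i) (ζ i k ω)
        = exactY W η g ξ xinit h0 k ω i - (exactCedas W η g ξ xinit h0 k ω).h i :=
      ae_all_iff.2 fun i => hc.ae_eq hi ((hy i).sub (hh i)) i k
    filter_upwards [ih, hq] with ω h1 h2
    have h3 : cedas W 1 (1 / 2) (fun _ => η) g ξ 𝒞 ζ xinit h0 (k + 1) ω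
        = step W 1 (1 / 2) η (fun i v => 𝒞 v (ζ i k ω))
          (fun i => g i ((exactCedas W η g ξ xinit h0 k ω).x i) (ξ i (k + 1) ω))
          (exactCedas W η g ξ xinit h0 k ω) := by
      rw [← h1]
      rfl
    rw [h3, exactCedas_succ]
    exact step_congr h2

/-- With the shifted indexing, `x t` depends on the samples `0, …, t` and its noise uses sample `t +
1`. The index set for the initialization is empty, as `xinit` is deterministic. -/
theorem exactCedas_isRun (hs : IsSmoothBelow L f fInf) (ho : IsGradientOracle P σ f g ξ)
    (hi : IsIndependentNoise P ξ ζ) :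
    IsRun P W f η σ xinit (past ξ {a | a.2 < 0}) (fun t => past ξ {a | a.2 < t + 1})
      (fun ω i => g i (xinit i) (ξ i 0 ω) - gradient (f i) (xinit i))
      (fun t ω => (exactCedas W η g ξ xinit h0 t ω).x)
      (fun t ω => (exactCedas W η g ξ xinit h0 t ω).d)
      (exactY W η g ξ xinit h0) (exactNoise W η g ξ xinit h0 f) := by
  have hm : ∀ t, _ := fun t => measurable_past_exactCedas (W := W) (η := η) (xinit := xinit)
      (h0 := h0) (ξ := ξ) (S := {a | a.2 < t + 1}) (k := t) ho.measurable
      fun _ l hl => Nat.lt_succ_of_le hl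
  have h0n := ho.isNoise hs hi (S := {a | a.2 < 0}) (x := fun i _ => xinit i) (k := 0)
    (fun i => measurable_const) (by simp)
  have hnoise : ∀ t, IsNoise P (past ξ {a | a.2 < t + 1}) σ
      fun i ω => exactNoise W η g ξ xinit h0 f t ω i := fun t =>
    ho.isNoise hs hi (S := {a | a.2 < t + 1}) (k := t + 1) (hm t).1 (by simp)
  have hy_eq : ∀ t ω i, exactY W η g ξ xinit h0 t ω i = (exactCedas W η g ξ xinit h0 t ω).x i
      - η • (gradient (f i) ((exactCedas W η g ξ xinit h0 t ω).x i)
        + exactNoise W η g ξ xinit h0 f t ω i) - (exactCedas W η g ξ xinit h0 t ω).d i := by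
    intro t ω i
    rw [exactNoise, add_sub_cancel]
    rfl
  have hL2 : ∀ t, (∀ i, MemLp (fun ω => (exactCedas W η g ξ xinit h0 t ω).x i) 2 P) ∧
      ∀ i, MemLp (fun ω => (exactCedas W η g ξ xinit h0 t ω).d i) 2 P := by
    intro t
    induction t with
    | zero =>
      refine ⟨fun i => ?_, fun i => memLp_const _⟩
      have h1 := ((memLp_const (xinit i)).sub
        (((memLp_const (gradient (f i) (xinit i))).add (h0n.memLp i)).const_smul η))
      exact h1.ae_eq (Filter.Eventually.of_forall fun ω => by
        simp [exactCedas, cedas, initState, -smul_add])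
    | succ t ih =>
      have hy : ∀ i, MemLp (fun ω => exactY W η g ξ xinit h0 t ω i) 2 P := by
        intro i
        simp_rw [hy_eq]
        exact ((ih.1 i).sub (((hs.memLp_gradient i (ih.1 i)).add
          ((hnoise t).memLp i)).const_smul η)).sub (ih.2 i)
      have hz : ∀ i, MemLp (fun ω => (1 / 4 : ℝ) • (exactY W η g ξ xinit h0 t ω i
          - ∑ j, W i j • exactY W η g ξ xinit h0 t ω j)) 2 P := fun i =>
        ((hy i).sub (memLp_finsetSum Finset.univ fun j _ =>
          (hy j).const_smul (W i j))).const_smul (1 / 4 : ℝ)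
      simp_rw [exactCedas_x_succ, exactCedas_d_succ]
      exact ⟨fun i => (hy i).sub (hz i), fun i => (ih.2 i).add (hz i)⟩
  exact
    { noise_init := h0n
      noise := hnoise
      measurable_x := fun t => (hm t).1
      memLp_x := fun t => (hL2 t).1
      memLp_d := fun t => (hL2 t).2
      x_zero := fun ω i => by simp [exactCedas, cedas, initState]
      d_zero := fun ω i => rfl
      y_eq := hy_eq
      x_succ := exactCedas_x_succ
      d_succ := exactCedas_d_succ }

theorem stackedNorm_sq (v : Fin n → EuclideanSpace ℝ (Fin p)) :
    stackedNorm v ^ 2 = ∑ i, ‖v i‖ ^ 2 :=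
  Real.sq_sqrt (Finset.sum_nonneg fun _ _ => sq_nonneg _)

/-- The centralized rate of the algorithm without compression error. -/
theorem hasCentralizedRate {G : SimpleGraph (Fin n)} {Δ cx cg : ℝ} {K : ℕ} (hn : 2 ≤ n)
    (hW : IsMixingMatrix G W) (hL : 0 < L)
    (hs : IsSmoothBelow L f fInf) (ho : IsGradientOracle P σ f g ξ)
    (hc : IsUnbiasedCompressor P 0 𝒞 ζ) (hi : IsIndependentNoise P ξ ζ)
    (hΔ : objective f (avg xinit) - avg fInf ≤ Δ)
    (hcx : stackedNorm xinit ^ 2 ≤ cx * (n : ℝ) ^ 2)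
    (hcg : stackedNorm (fun i => gradient (f i) (xinit i)) ^ 2 ≤ cg * (n : ℝ) ^ 2)
    (hK0 : 512 * n * L ^ 2 / (1 - lambda2 hn hW.symm) ^ 2 ≤ K)
    (hK1 : rateConst L σ cx cg ^ 2 * (n ^ 3 / (1 - lambda2 hn hW.symm) ^ 2) ≤ K) :
    HasCentralizedRate P f (2 * |Δ| + 3 * L * σ ^ 2 + 1) K (fun t ω =>
      (cedas W 1 (1 / 2) (fun _ => Real.sqrt ((n : ℝ) / K)) g ξ 𝒞 ζ xinit h0 t ω).x) := by
  obtain ⟨hlt, hge, u, μ, a₀, hu⟩ := hW.exists_modeSystem hn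
  have hr := exactCedas_isRun (W := W) (η := Real.sqrt ((n : ℝ) / K)) (xinit := xinit)
    (h0 := h0) hs ho hi
  have hrate := hr.rate (by omega) hs hu hW.symm_apply hW.col_sum (by linarith) hge hL hΔ
    (by rwa [← stackedNorm_sq]) (by rwa [← stackedNorm_sq]) hK0 hK1
  have hae : ∀ t, (fun ω => ‖gradient (objective f) (avg (cedas W 1 (1 / 2)
      (fun _ => Real.sqrt ((n : ℝ) / K)) g ξ 𝒞 ζ xinit h0 t ω).x)‖ ^ 2) =ᵐ[P]
      fun ω => ‖gradient (objective f)
        (avg (exactCedas W (Real.sqrt ((n : ℝ) / K)) g ξ xinit h0 t ω).x)‖ ^ 2 := by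
    intro t
    filter_upwards [ae_cedas_eq_exactCedas (W := W) (η := Real.sqrt ((n : ℝ) / K))
      (xinit := xinit) (h0 := h0) ho.measurable hc hi t] with ω hω
    rw [hω]
  refine ⟨fun t _ => ?_, ?_⟩
  · exact (integrable_norm_sq (hs.memLp_gradient_objective
      (memLp_avg (hr.memLp_x t)))).congr (hae t).symm
  · simp_rw [fun t => integral_congr_ae (hae t)]
    exact hrate

end Algorithm

end CEDAS

/-! ### The transient time. -/

theorem mainTheorem11 (L σ Δ : ℝ) (hL : 0 < L) (hσ : 0 < σ) :
    ∃ A : ℝ, 0 < A ∧ ∀ cx ch cg cl q : ℝ, 0 < q → ∃ B : ℝ, 0 < B ∧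
      ∀ (n p : ℕ) (hn : 2 ≤ n) (G : SimpleGraph (Fin n)) (W : Matrix (Fin n) (Fin n) ℝ)
        (hW : CEDAS.IsMixingMatrix G W)
        (f : Fin n → EuclideanSpace ℝ (Fin p) → ℝ) (fInf : Fin n → ℝ)
        (Ω Ξ Z : Type*) [MeasurableSpace Ω] [MeasurableSpace Ξ] [MeasurableSpace Z]
        (P : MeasureTheory.Measure Ω) [MeasureTheory.IsProbabilityMeasure P]
        (g : Fin n → EuclideanSpace ℝ (Fin p) → Ξ → EuclideanSpace ℝ (Fin p))
        (ξ : Fin n → ℕ → Ω → Ξ)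
        (𝒞 : EuclideanSpace ℝ (Fin p) → Z → EuclideanSpace ℝ (Fin p))
        (ζ : Fin n → ℕ → Ω → Z)
        (xinit h0 : Fin n → EuclideanSpace ℝ (Fin p)),
        CEDAS.IsSmoothBelow L f fInf →
        CEDAS.IsGradientOracle P σ f g ξ →
        CEDAS.IsUnbiasedCompressor P 0 𝒞 ζ →
        CEDAS.IsIndependentNoise P ξ ζ →
        CEDAS.objective f (CEDAS.avg xinit) - CEDAS.avg fInf ≤ Δ →
        CEDAS.stackedNorm xinit ^ 2 ≤ cx * (n : ℝ) ^ 2 →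
        CEDAS.stackedNorm h0 ≤ ch * (n : ℝ) ^ 2 →
        CEDAS.stackedNorm (fun i => gradient (f i) (xinit i)) ^ 2 ≤ cg * (n : ℝ) ^ 2 →
        1 / (1 - CEDAS.lambda2 hn hW.symm) ≤ cl * (n : ℝ) ^ q →
        ∃ T : ℕ,
          CEDAS.IsTransientTime P f A (512 * n * L ^ 2 / (1 - CEDAS.lambda2 hn hW.symm) ^ 2)
            (fun K t ω =>
              (CEDAS.cedas W 1 (1 / 2) (fun _ => Real.sqrt ((n : ℝ) / K)) g ξ 𝒞 ζ xinit h0 t ω).x)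
            T ∧
          (T : ℝ) ≤ B * ((n : ℝ) ^ 3 / (1 - CEDAS.lambda2 hn hW.symm) ^ 2) := by
  -- In `A`, the terms in `Δ` and `σ` are the centralized ones (with `|Δ|`, as `Δ` may be negative)
  -- and the `1` pays for the whole remainder. In `B`, the summands cover the remainder threshold,
  -- the lower bound on admissible horizons (through `n ≤ n³`), and rounding up (through `1 ≤ R`).
  refine ⟨2 * |Δ| + 3 * L * σ ^ 2 + 1, by positivity, fun cx _ cg _ _ _ =>
    ⟨CEDAS.rateConst L σ cx cg ^ 2 + 512 * L ^ 2 + 1, by positivity, ?_⟩⟩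
  intro n p hn G W hW f fInf Ω Ξ Z _ _ _ P _ g ξ 𝒞 ζ xinit h0 hs ho hc hi hΔ hcx _ hcg _
  obtain ⟨hlt, hge, -⟩ := hW.exists_modeSystem hn
  set β := 1 - CEDAS.lambda2 hn hW.symm with hβdef
  have hβ : 0 < β := by linarith
  have hn2 : (2 : ℝ) ≤ n := by exact_mod_cast hn
  set R : ℝ := (n : ℝ) ^ 3 / β ^ 2 with hR
  have hR1 : 1 ≤ R := by
    rw [hR, le_div_iff₀ (by positivity)]
    have h1 : (2 : ℝ) ^ 3 ≤ (n : ℝ) ^ 3 := by gcongr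
    nlinarith
  have hnR : 512 * n * L ^ 2 / β ^ 2 ≤ 512 * L ^ 2 * R := by
    rw [hR, ← mul_div_assoc]
    have h1 : (n : ℝ) ≤ (n : ℝ) ^ 3 := le_self_pow₀ (by linarith) (by norm_num)
    gcongr ?_ / _
    nlinarith [mul_le_mul_of_nonneg_left h1 (show 0 ≤ 512 * L ^ 2 by positivity)]
  set Q2 := CEDAS.rateConst L σ cx cg ^ 2 with hQ2
  have hQ0 : 0 ≤ Q2 := sq_nonneg _
  obtain ⟨T₀, hT₀⟩ : ∃ T₀ : ℕ, T₀ = ⌈(Q2 + 512 * L ^ 2) * R⌉₊ := ⟨_, rfl⟩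
  have hT₀le : (Q2 + 512 * L ^ 2) * R ≤ T₀ := hT₀ ▸ Nat.le_ceil _
  have hT₀lt : (T₀ : ℝ) < (Q2 + 512 * L ^ 2) * R + 1 :=
    hT₀ ▸ Nat.ceil_lt_add_one (by positivity)
  have hmem : T₀ ∈ {K : ℕ | 512 * n * L ^ 2 / β ^ 2 ≤ K ∧ ∀ k ≥ K,
      CEDAS.HasCentralizedRate P f (2 * |Δ| + 3 * L * σ ^ 2 + 1) k fun t ω =>
        (CEDAS.cedas W 1 (1 / 2) (fun _ => Real.sqrt ((n : ℝ) / k)) g ξ 𝒞 ζ xinit h0 t ω).x} := by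
    have hQR : 0 ≤ Q2 * R := by positivity
    have hLR : 0 ≤ 512 * L ^ 2 * R := by positivity
    refine ⟨by linarith, fun k hk => ?_⟩
    have hk' : (T₀ : ℝ) ≤ k := by exact_mod_cast hk
    exact CEDAS.hasCentralizedRate hn hW hL hs ho hc hi hΔ hcx hcg
      (show 512 * n * L ^ 2 / β ^ 2 ≤ k by linarith) (show Q2 * R ≤ k by linarith)
  refine ⟨sInf _, ⟨Nat.sInf_mem ⟨T₀, hmem⟩, fun _ h => Nat.sInf_le h⟩, ?_⟩
  have h1 : ((sInf _ : ℕ) : ℝ) ≤ T₀ := Nat.cast_le.2 (Nat.sInf_le hmem)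
  refine h1.trans ?_
  linarith
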